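/- Let $h:\mathbb R\to(0,\infty)$ be continuous and let $M,c_+,c_->0$, $m\ge 1$ be real numbers such that (i) $x=0$ is the only point of global maximum of $h$; (ii) $h$ is $C^1$ on $\mathbb R\setminus\{0\}$, $h'$ is square integrable near $0$, and, as $x\to0$, $$h(x)=M-c_+x^m+O(x^{m+1})\ \ (x>0),\qquad h(x)=M-c_-|x|^m+O(|x|^{m+1})\ \ (x<0);$$ (iii) $\limsup_{|x|\to\infty}h(x)<M$. For $\varepsilon>0$ put $$W_\varepsilon(x)=\frac{\pi^2}{\varepsilon^2}\Bigl(\frac1{h(x)^2}-\frac1{M^2}\Bigr)+\Bigl(\frac{\pi^2}{3}+\frac14\Bigr)\frac{h'(x)^2}{h(x)^2},\qquad q(x)=\begin{cases}2\pi^2M^{-3}c_+x^m,&x>0,\\ 2\pi^2M^{-3}c_-|x|^m,&x<0,\end{cases}$$ and $\alpha=2/(m+2)$. Let $\mathbf Q_\varepsilon=-\frac{d^2}{dx^2}+W_\varepsilon$ and $\mathbf H_\varepsilon=-\frac{d^2}{dx^2}+\varepsilon^{-2}q$ be the operators in $L^2(\mathbb R)$ (of real- or complex-valued functions) generated by the quadratic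 forms $\int_{\mathbb R}(|\chi'|^2+V|\chi|^2)\,dx$ with domain $\{\chi\in H^1(\mathbb R):\int_{\mathbb R} V|\chi|^2\,dx<\infty\}$, where $V=W_\varepsilon$ and $V=\varepsilon^{-2}q$, respectively. Then for every $\varepsilon>0$ the operators $\varepsilon^{2\alpha}\mathbf Q_\varepsilon$ and $\varepsilon^{2\alpha}\mathbf H_\varepsilon$ have bounded everywhere defined inverses, and $$\lim_{\varepsilon\to0+}\bigl\|(\varepsilon^{2\alpha}\mathbf Q_\varepsilon)^{-1}-(\varepsilon^{2\alpha}\mathbf H_\varepsilon)^{-1}\bigr\|=0 .$$ -/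

import Mathlib

open MeasureTheory Filter Topology Asymptotics
open scoped ContDiff ENNReal InnerProductSpace ComplexConjugate

namespace ThinStrip

/-- The Hilbert space `L²(ℝ)` of `𝕜`-valued functions, `𝕜 = ℝ` or `ℂ`. -/
abbrev L2 (𝕜 : Type*) [RCLike 𝕜] : Type _ := Lp 𝕜 2 (volume : Measure ℝ)

/-! ### The first derivative on `H¹(ℝ)` -/

/-- `g` is the weak derivative of `u`: `∫ φ' u = -∫ φ g` for all `φ ∈ C_c^∞(ℝ)`. -/
def HasWeakDeriv {𝕜 : Type*} [RCLike 𝕜] (u g : L2 𝕜) : Prop :=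
  ∀ φ : ℝ → ℝ, ContDiff ℝ ∞ φ → HasCompactSupport φ →
    ∫ x, deriv φ x • u x = -∫ x, φ x • g x

lemma locallyIntegrable_L2 {𝕜 : Type*} [RCLike 𝕜] (u : L2 𝕜) :
    LocallyIntegrable (u : ℝ → 𝕜) volume :=
  (Lp.memLp u).locallyIntegrable (by norm_num)

lemma integrable_test_smul {𝕜 : Type*} [RCLike 𝕜] (u : L2 𝕜) {φ : ℝ → ℝ}
    (hφ : Continuous φ) (hc : HasCompactSupport φ) :
    Integrable (fun x => φ x • u x) volume :=
  (locallyIntegrable_L2 u).integrable_smul_left_of_hasCompactSupport hφ hc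

lemma integral_test_add {𝕜 : Type*} [RCLike 𝕜] (u v : L2 𝕜) {φ : ℝ → ℝ}
    (hφ : Continuous φ) (hc : HasCompactSupport φ) :
    ∫ x, φ x • (u + v : L2 𝕜) x = (∫ x, φ x • u x) + ∫ x, φ x • v x := by
  rw [← integral_add (integrable_test_smul u hφ hc) (integrable_test_smul v hφ hc)]
  refine integral_congr_ae ?_
  filter_upwards [Lp.coeFn_add u v] with x hx
  rw [hx, Pi.add_apply, smul_add]

lemma integral_test_smul {𝕜 : Type*} [RCLike 𝕜] (c : 𝕜) (u : L2 𝕜) (φ : ℝ → ℝ) :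
    ∫ x, φ x • (c • u : L2 𝕜) x = c • ∫ x, φ x • u x := by
  rw [← integral_smul]
  refine integral_congr_ae ?_
  filter_upwards [Lp.coeFn_smul c u] with x hx
  simp only [hx, Pi.smul_apply]
  rw [smul_comm]

/-- The graph of the weak derivative in `L²(ℝ)`. -/
def weakDerivGraph (𝕜 : Type*) [RCLike 𝕜] : Submodule 𝕜 (L2 𝕜 × L2 𝕜) where
  carrier := {p | HasWeakDeriv p.1 p.2}
  zero_mem' := by
    intro φ hφ hc
    have h (ψ : ℝ → ℝ) : ∫ x, ψ x • (0 : L2 𝕜) x = 0 := by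
      have := integral_test_smul (0 : 𝕜) (0 : L2 𝕜) ψ
      rwa [zero_smul, zero_smul] at this
    rw [Prod.fst_zero, Prod.snd_zero, h, h, neg_zero]
  add_mem' := by
    intro p q hp hq φ hφ hc
    have hd : Continuous (deriv φ) := hφ.continuous_deriv (by norm_num)
    simp only [Prod.fst_add, Prod.snd_add]
    rw [integral_test_add _ _ hd hc.deriv, integral_test_add _ _ hφ.continuous hc,
      hp φ hφ hc, hq φ hφ hc, neg_add]
  smul_mem' := by
    intro c p hp φ hφ hc
    simp only [Prod.smul_fst, Prod.smul_snd]
    rw [integral_test_smul, integral_test_smul, hp φ hφ hc, smul_neg]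

/-- The weak derivative of an `L²` function is unique. -/
lemma weakDerivGraph_functional (𝕜 : Type*) [RCLike 𝕜] (p : L2 𝕜 × L2 𝕜)
    (hp : p ∈ weakDerivGraph 𝕜) (h0 : p.1 = 0) : p.2 = 0 := by
  have key : ∀ᵐ x ∂(volume : Measure ℝ), (p.2 : ℝ → 𝕜) x = 0 := by
    refine ae_eq_zero_of_integral_contDiff_smul_eq_zero (locallyIntegrable_L2 p.2) ?_
    intro φ hφ hc
    have h1 : HasWeakDeriv p.1 p.2 := hp
    have h2 := h1 φ hφ hc
    have h3 : ∫ x, deriv φ x • (p.1 : ℝ → 𝕜) x = 0 := by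
      have := integral_test_smul (0 : 𝕜) (0 : L2 𝕜) (deriv φ)
      rw [h0]
      rwa [zero_smul, zero_smul] at this
    rw [h3] at h2
    exact neg_eq_zero.mp h2.symm
  exact (Lp.eq_zero_iff_ae_eq_zero).2 key

/-- The operator `d/dx` in `L²(ℝ)`; its domain is the Sobolev space `H¹(ℝ)`, the set of
all `u ∈ L²(ℝ)` that have a weak derivative in `L²(ℝ)`. -/
noncomputable def weakDeriv (𝕜 : Type*) [RCLike 𝕜] : L2 𝕜 →ₗ.[𝕜] L2 𝕜 :=
  (weakDerivGraph 𝕜).toLinearPMap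

lemma hasWeakDeriv_weakDeriv {𝕜 : Type*} [RCLike 𝕜] (u : (weakDeriv 𝕜).domain) :
    HasWeakDeriv (u : L2 𝕜) (weakDeriv 𝕜 u) :=
  Submodule.mem_graph_toLinearPMap (weakDerivGraph_functional 𝕜) u

lemma mem_weakDeriv_domain_iff {𝕜 : Type*} [RCLike 𝕜] (u : L2 𝕜) :
    u ∈ (weakDeriv 𝕜).domain ↔ ∃ g : L2 𝕜, HasWeakDeriv u g := by
  simp only [weakDeriv, Submodule.toLinearPMap_domain, Submodule.mem_map, LinearMap.fst_apply,
    Prod.exists, exists_and_right, exists_eq_right]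
  rfl

/-! ### Multiplication by the square root of a potential -/

lemma memLp_mul_add {𝕜 : Type*} [RCLike 𝕜] {w : ℝ → ℝ} {u v : L2 𝕜}
    (hu : MemLp (fun x => (w x : 𝕜) * u x) 2 (volume : Measure ℝ))
    (hv : MemLp (fun x => (w x : 𝕜) * v x) 2 (volume : Measure ℝ)) :
    MemLp (fun x => (w x : 𝕜) * (u + v : L2 𝕜) x) 2 (volume : Measure ℝ) := by
  refine (memLp_congr_ae ?_).2 (hu.add hv)
  filter_upwards [Lp.coeFn_add u v] with x hx
  simp only [hx, Pi.add_apply, mul_add]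

lemma memLp_mul_smul {𝕜 : Type*} [RCLike 𝕜] {w : ℝ → ℝ} (c : 𝕜) {u : L2 𝕜}
    (hu : MemLp (fun x => (w x : 𝕜) * u x) 2 (volume : Measure ℝ)) :
    MemLp (fun x => (w x : 𝕜) * (c • u : L2 𝕜) x) 2 (volume : Measure ℝ) := by
  refine (memLp_congr_ae ?_).2 (hu.const_smul c)
  filter_upwards [Lp.coeFn_smul c u] with x hx
  simp only [hx, Pi.smul_apply, smul_eq_mul]
  ring

/-- The operator of multiplication by the real function `w` in `L²(ℝ)`, on its maximal domain
`{u ∈ L²(ℝ) : w u ∈ L²(ℝ)}`. -/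
noncomputable def mulOp (𝕜 : Type*) [RCLike 𝕜] (w : ℝ → ℝ) : L2 𝕜 →ₗ.[𝕜] L2 𝕜 where
  domain :=
    { carrier := {u | MemLp (fun x => (w x : 𝕜) * u x) 2 (volume : Measure ℝ)}
      zero_mem' := by
        refine (memLp_congr_ae ?_).2 (MemLp.zero' (ε := 𝕜) (p := 2) (μ := (volume : Measure ℝ)))
        filter_upwards [Lp.coeFn_zero 𝕜 2 (volume : Measure ℝ)] with x hx
        simp
      add_mem' := fun hu hv => memLp_mul_add hu hv
      smul_mem' := fun c _ hu => memLp_mul_smul c hu }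
  toFun :=
    { toFun := fun u => MemLp.toLp (fun x => (w x : 𝕜) * (u : L2 𝕜) x) u.2
      map_add' := by
        intro u v
        rw [← MemLp.toLp_add]
        refine MemLp.toLp_congr _ _ ?_
        filter_upwards [Lp.coeFn_add (u : L2 𝕜) v] with x hx
        simp only [Submodule.coe_add, hx, Pi.add_apply, mul_add]
      map_smul' := by
        intro c u
        rw [RingHom.id_apply, ← MemLp.toLp_const_smul]
        refine MemLp.toLp_congr _ _ ?_
        filter_upwards [Lp.coeFn_smul c (u : L2 𝕜)] with x hx
        simp only [Submodule.coe_smul, hx, Pi.smul_apply, smul_eq_mul]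
        ring }

/-! ### Schrödinger operators with a non-negative potential, through their quadratic forms -/

/-- The form domain `{u ∈ H¹(ℝ) : ∫ V |u|² < ∞}` for a potential `V ≥ 0`. -/
noncomputable def formDomain (𝕜 : Type*) [RCLike 𝕜] (V : ℝ → ℝ) : Submodule 𝕜 (L2 𝕜) :=
  (weakDeriv 𝕜).domain ⊓ (mulOp 𝕜 fun x => √(V x)).domain

lemma formDomain.mem_deriv {𝕜 : Type*} [RCLike 𝕜] {V : ℝ → ℝ} {u : L2 𝕜}
    (hu : u ∈ formDomain 𝕜 V) : u ∈ (weakDeriv 𝕜).domain := hu.1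

lemma formDomain.mem_mul {𝕜 : Type*} [RCLike 𝕜] {V : ℝ → ℝ} {u : L2 𝕜}
    (hu : u ∈ formDomain 𝕜 V) : u ∈ (mulOp 𝕜 fun x => √(V x)).domain := hu.2

/-- The sesquilinear form `⟨u', v'⟩ + ⟨√V u, √V v⟩ = ∫ (conj u' v' + V conj u v)` on the form
domain, for a potential `V ≥ 0`; its quadratic form is `∫ (|u'|² + V |u|²)`. -/
noncomputable def form {𝕜 : Type*} [RCLike 𝕜] (V : ℝ → ℝ) (u v : formDomain 𝕜 V) : 𝕜 :=
  ⟪weakDeriv 𝕜 ⟨u, formDomain.mem_deriv u.2⟩, weakDeriv 𝕜 ⟨v, formDomain.mem_deriv v.2⟩⟫_𝕜 +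
    ⟪mulOp 𝕜 (fun x => √(V x)) ⟨u, formDomain.mem_mul u.2⟩,
      mulOp 𝕜 (fun x => √(V x)) ⟨v, formDomain.mem_mul v.2⟩⟫_𝕜

/-- For `V ≥ 0` measurable, the form domain is `{u ∈ H¹(ℝ) : ∫ V |u|² < ∞}`. -/
lemma mem_formDomain_iff {𝕜 : Type*} [RCLike 𝕜] {V : ℝ → ℝ} (hV : ∀ x, 0 ≤ V x)
    (hm : Measurable V) (u : L2 𝕜) :
    u ∈ formDomain 𝕜 V ↔
      (∃ g : L2 𝕜, HasWeakDeriv u g) ∧ Integrable (fun x => V x * ‖u x‖ ^ 2) volume := by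
  have h1 : u ∈ formDomain 𝕜 V ↔ u ∈ (weakDeriv 𝕜).domain ∧
      MemLp (fun x => ((√(V x) : ℝ) : 𝕜) * u x) 2 (volume : Measure ℝ) := Iff.rfl
  have h2 : AEStronglyMeasurable (fun x => ((√(V x) : ℝ) : 𝕜) * u x) (volume : Measure ℝ) :=
    (RCLike.measurable_ofReal.comp hm.sqrt).aestronglyMeasurable.mul
      (Lp.aestronglyMeasurable u)
  rw [h1, mem_weakDeriv_domain_iff, memLp_two_iff_integrable_sq_norm h2]
  have h3 : (fun x => ‖((√(V x) : ℝ) : 𝕜) * u x‖ ^ 2) = fun x => V x * ‖u x‖ ^ 2 := by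
    funext x
    rw [norm_mul, mul_pow, RCLike.norm_ofReal, sq_abs, Real.sq_sqrt (hV x)]
  rw [h3]

/-- For `V ≥ 0`, the form is `∫ conj u' v' + ∫ V conj u v`. -/
lemma form_eq {𝕜 : Type*} [RCLike 𝕜] {V : ℝ → ℝ} (hV : ∀ x, 0 ≤ V x) (u v : formDomain 𝕜 V) :
    form V u v =
      (∫ x, conj (weakDeriv 𝕜 ⟨u, formDomain.mem_deriv u.2⟩ x) * weakDeriv 𝕜 ⟨v, formDomain.mem_deriv v.2⟩ x) +
        ∫ x, (V x : 𝕜) * (conj ((u : L2 𝕜) x) * (v : L2 𝕜) x) := by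
  unfold form
  rw [L2.inner_def, L2.inner_def]
  congr 1
  · refine integral_congr_ae (Eventually.of_forall fun x => ?_)
    exact (RCLike.inner_apply _ _).trans (mul_comm _ _)
  · refine integral_congr_ae ?_
    have hu : mulOp 𝕜 (fun x => √(V x)) ⟨u, formDomain.mem_mul u.2⟩ =ᵐ[volume]
      fun x => ((√(V x) : ℝ) : 𝕜) * (u : L2 𝕜) x := MemLp.coeFn_toLp (formDomain.mem_mul u.2)
    have hv : mulOp 𝕜 (fun x => √(V x)) ⟨v, formDomain.mem_mul v.2⟩ =ᵐ[volume]
      fun x => ((√(V x) : ℝ) : 𝕜) * (v : L2 𝕜) x := MemLp.coeFn_toLp (formDomain.mem_mul v.2)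
    filter_upwards [hu, hv] with x h1 h2
    rw [h1, h2]
    have h3 : ((√(V x) : ℝ) : 𝕜) * ((√(V x) : ℝ) : 𝕜) = (V x : 𝕜) := by
      rw [← RCLike.ofReal_mul, Real.mul_self_sqrt (hV x)]
    rw [← h3, RCLike.inner_apply, map_mul, RCLike.conj_ofReal]
    ring

/-- The graph of the operator generated by the form: `u ↦ f` when `u` is in the form domain and
`form u v = ⟨f, v⟩` for all `v` in the form domain. -/
def schrodingerGraph (𝕜 : Type*) [RCLike 𝕜] (V : ℝ → ℝ) : Submodule 𝕜 (L2 𝕜 × L2 𝕜) where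
  carrier := {p | ∃ hp : p.1 ∈ formDomain 𝕜 V,
    ∀ v : formDomain 𝕜 V, form V ⟨p.1, hp⟩ v = ⟪p.2, (v : L2 𝕜)⟫_𝕜}
  zero_mem' := by
    refine ⟨(formDomain 𝕜 V).zero_mem, fun v => ?_⟩
    have h1 : weakDeriv 𝕜 ⟨0, (weakDeriv 𝕜).domain.zero_mem⟩ = 0 := (weakDeriv 𝕜).map_zero
    have h2 : mulOp 𝕜 (fun x => √(V x)) ⟨0, (mulOp 𝕜 _).domain.zero_mem⟩ = 0 :=
      (mulOp 𝕜 fun x => √(V x)).map_zero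
    simp only [form, Prod.fst_zero, Prod.snd_zero, h1, h2, inner_zero_left, add_zero]
  add_mem' := by
    rintro p q ⟨hp, hp'⟩ ⟨hq, hq'⟩
    refine ⟨(formDomain 𝕜 V).add_mem hp hq, fun v => ?_⟩
    have h1 := (weakDeriv 𝕜).map_add ⟨p.1, formDomain.mem_deriv hp⟩ ⟨q.1, formDomain.mem_deriv hq⟩
    have h2 := (mulOp 𝕜 fun x => √(V x)).map_add ⟨p.1, formDomain.mem_mul hp⟩ ⟨q.1, formDomain.mem_mul hq⟩
    have h3 := hp' v
    have h4 := hq' v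
    simp only [AddMemClass.mk_add_mk] at h1 h2
    simp only [form] at h3 h4 ⊢
    simp only [Prod.fst_add, Prod.snd_add, h1, h2, inner_add_left, ← h3, ← h4]
    ring
  smul_mem' := by
    rintro c p ⟨hp, hp'⟩
    refine ⟨(formDomain 𝕜 V).smul_mem c hp, fun v => ?_⟩
    have h1 := (weakDeriv 𝕜).map_smul c ⟨p.1, formDomain.mem_deriv hp⟩
    have h2 := (mulOp 𝕜 fun x => √(V x)).map_smul c ⟨p.1, formDomain.mem_mul hp⟩
    have h3 := hp' v
    simp only [SetLike.mk_smul_mk] at h1 h2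
    simp only [form] at h3 ⊢
    simp only [Prod.smul_fst, Prod.smul_snd, h1, h2, inner_smul_left, ← h3]
    ring

/-- The Schrödinger operator `-d²/dx² + V` in `L²(ℝ)` with potential `V ≥ 0`: the (self-adjoint)
operator generated by the quadratic form `∫ (|u'|² + V |u|²)` on its natural domain. -/
noncomputable def schrodingerOp (𝕜 : Type*) [RCLike 𝕜] (V : ℝ → ℝ) : L2 𝕜 →ₗ.[𝕜] L2 𝕜 :=
  (schrodingerGraph 𝕜 V).toLinearPMap

/-- `schrodingerOp` has the intended graph whenever the form domain is dense. -/
lemma schrodingerOp_graph {𝕜 : Type*} [RCLike 𝕜] {V : ℝ → ℝ}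
    (hd : Dense (formDomain 𝕜 V : Set (L2 𝕜))) :
    (schrodingerOp 𝕜 V).graph = schrodingerGraph 𝕜 V := by
  refine Submodule.toLinearPMap_graph_eq _ ?_
  rintro ⟨u, f⟩ ⟨hu, h⟩ h0
  simp only at h0 hu h
  subst h0
  have h1 : weakDeriv 𝕜 ⟨0, formDomain.mem_deriv hu⟩ = 0 := (weakDeriv 𝕜).map_zero
  have h2 : mulOp 𝕜 (fun x => √(V x)) ⟨0, formDomain.mem_mul hu⟩ = 0 := (mulOp 𝕜 fun x => √(V x)).map_zero
  refine hd.eq_zero_of_inner_left 𝕜 fun v hv => ?_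
  rw [← h ⟨v, hv⟩]
  simp only [form, h1, h2, inner_zero_left, add_zero]

/-- The everywhere defined bounded operator `T` is the inverse `A⁻¹` of the operator `A`. -/
def IsBoundedInverse {𝕜 : Type*} [RCLike 𝕜] (A : L2 𝕜 →ₗ.[𝕜] L2 𝕜) (T : L2 𝕜 →L[𝕜] L2 𝕜) :
    Prop :=
  (∀ f : L2 𝕜, ∃ hf : T f ∈ A.domain, A ⟨T f, hf⟩ = f) ∧ ∀ u : A.domain, T (A u) = u

/-! ### The strip and its two one-dimensional operators -/

/-- The hypotheses on the profile `h` of the strip `{(x, y) : 0 < y < ε h(x)}`. -/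
structure IsProfile (h : ℝ → ℝ) (M cp cm m : ℝ) : Prop where
  continuous : Continuous h
  pos : ∀ x, 0 < h x
  M_pos : 0 < M
  cp_pos : 0 < cp
  cm_pos : 0 < cm
  one_le_m : 1 ≤ m
  /-- `x = 0` is the only point of global maximum. -/
  lt_of_ne : ∀ x, x ≠ 0 → h x < h 0
  /-- `h` is `C¹` away from `0`. -/
  contDiffOn : ContDiffOn ℝ 1 h {0}ᶜ
  /-- `h'` is square integrable near `0`; equivalently, `W` below is locally integrable. -/
  deriv_sq : LocallyIntegrable (fun x => deriv h x ^ 2) volume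
  /-- `h x = M - c₊ x ^ m + O(x ^ (m + 1))` as `x → 0+`. -/
  expansion_right :
    (fun x => h x - (M - cp * x ^ m)) =O[𝓝[>] (0 : ℝ)] fun x => x ^ (m + 1)
  /-- `h x = M - c₋ |x| ^ m + O(|x| ^ (m + 1))` as `x → 0-`. -/
  expansion_left :
    (fun x => h x - (M - cm * |x| ^ m)) =O[𝓝[<] (0 : ℝ)] fun x => |x| ^ (m + 1)
  /-- `limsup h x < M` as `|x| → ∞`. -/
  limsup_lt : limsup h (cocompact ℝ) < M

/-- `W_ε = (π² / ε²) (h⁻² - M⁻²) + (π² / 3 + 1 / 4) h'² / h²`. -/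
noncomputable def W (h : ℝ → ℝ) (M ε x : ℝ) : ℝ :=
  Real.pi ^ 2 / ε ^ 2 * (1 / h x ^ 2 - 1 / M ^ 2) +
    (Real.pi ^ 2 / 3 + 1 / 4) * (deriv h x ^ 2 / h x ^ 2)

/-- `q x = 2 π² M⁻³ c₊ x ^ m` for `x > 0` and `2 π² M⁻³ c₋ |x| ^ m` for `x < 0`. -/
noncomputable def q (M cp cm m x : ℝ) : ℝ :=
  2 * Real.pi ^ 2 / M ^ 3 * (if 0 < x then cp else cm) * |x| ^ m

/-- The operator `Q_ε = -d²/dx² + W_ε` in `L²(ℝ)`. -/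
noncomputable def Q (𝕜 : Type*) [RCLike 𝕜] (h : ℝ → ℝ) (M ε : ℝ) : L2 𝕜 →ₗ.[𝕜] L2 𝕜 :=
  schrodingerOp 𝕜 (W h M ε)

/-- The operator `H_ε = -d²/dx² + ε⁻² q` in `L²(ℝ)`. -/
noncomputable def H (𝕜 : Type*) [RCLike 𝕜] (M cp cm m ε : ℝ) : L2 𝕜 →ₗ.[𝕜] L2 𝕜 :=
  schrodingerOp 𝕜 (fun x => q M cp cm m x / ε ^ 2)

end ThinStrip

/-!
The two operators are compared through their quadratic forms, in the original variable `x`, with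
lengths measured in units of `δ = ε ^ α`. The exponent is chosen so that `δ ^ (m + 2) = ε ^ 2`: at
distance at least `Y δ` from the origin, where `Y δ ≤ 1`, both potentials are bounded below by a
constant times `Y ^ m / δ ^ 2` (`IsProfile.exists_lower`), so after multiplication by
`δ ^ 2 = ε ^ (2 α)` the problem lives on the scale `δ`.

Both inverses come from the Lax–Milgram argument `exists_form_solution`. Coercivity
(`norm_sq_le_energy`) only needs a potential that is non-negative and bounded below outside a compact
set, since an `H¹` function is controlled on `[-a, a]` by its derivative and its values on `(a, 2a]`.
Applied with `a = δ`, it gives `‖u‖ ≤ C ‖f‖`, `δ ‖u'‖ ≤ C ‖f‖` and, by the Sobolev inequality,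
`‖u‖_∞ ≤ C δ^(-1/2) ‖f‖` for the solution `u` of `δ ^ 2 (-u'' + V u) = f`, with `C` independent of
`ε` (`IsScaledSolution.bounds`, `IsScaledSolution.ae_norm_le`).

The two form domains differ, as the two potentials may grow differently at infinity. Hence the
solution `u` of one problem with datum `f` is tested against `χ v`, where `v` solves the other problem
with datum `g` and `χ` is a cutoff equal to `1` on `[-Y δ, Y δ]` with support in `[-2 Y δ, 2 Y δ]`;
conversely `v` is tested against `χ u`. In the difference the terms `χ u' v'` cancel
(`norm_inner_sub_le`), and what remains is
* the part of `u` and `v` outside `[-Y δ, Y δ]`, small because the potentials are large there;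
* terms with `χ'`, of order `1 / Y`;
* `δ ^ 2 ∫ χ (W - q / ε ^ 2) u v`, at most a constant times `δ` times the `L¹` distance of the two
  potentials on `[-2 Y δ, 2 Y δ]`.

For fixed `Y` the last term vanishes as `ε → 0` (`IsProfile.exists_integral_abs_sub_le`): the
singular part `h'² / h²` of `W` is locally integrable and independent of `ε`, and the well
`π² (h⁻² - M⁻²)` differs from `q` by `o(|x| ^ m)`. Letting `Y → ∞` afterwards gives the theorem.
-/

namespace ThinStrip

/-! ### Functions in `H¹(ℝ)` are Hölder continuous -/

lemma exists_Ioo_support {E : Type*} [Zero E] {φ : ℝ → E} (hc : HasCompactSupport φ) :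
    ∃ R : ℝ, 0 < R ∧ ∀ x, x ∉ Set.Ioo (-R) R → φ x = 0 := by
  obtain ⟨R, hR⟩ := hc.isCompact.isBounded.subset_closedBall 0
  refine ⟨|R| + 1, by positivity, fun x hx => ?_⟩
  by_contra h
  have h1 := hR (subset_tsupport _ h)
  rw [Real.closedBall_eq_Icc] at h1
  have := le_abs_self R
  exact hx ⟨by linarith [h1.1], by linarith [h1.2]⟩

/-- A test function with vanishing integral is the derivative of a test function. -/
lemma exists_primitive_hasCompactSupport {θ : ℝ → ℝ} (hθ : ContDiff ℝ ∞ θ)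
    (hc : HasCompactSupport θ) (h0 : ∫ x, θ x = 0) :
    ∃ ψ : ℝ → ℝ, ContDiff ℝ ∞ ψ ∧ HasCompactSupport ψ ∧ deriv ψ = θ := by
  obtain ⟨R, hR0, hR⟩ := exists_Ioo_support hc
  have hd : ∀ x, HasDerivAt (fun x => ∫ t in (-R)..x, θ t) (θ x) x := fun x =>
    (hθ.continuous.integral_hasStrictDerivAt (-R) x).hasDerivAt
  have hderiv : deriv (fun x => ∫ t in (-R)..x, θ t) = θ := funext fun x => (hd x).deriv
  refine ⟨fun x => ∫ t in (-R)..x, θ t, ?_, ?_, hderiv⟩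
  · rw [contDiff_infty_iff_deriv, hderiv]
    exact ⟨fun x => (hd x).differentiableAt, hθ⟩
  · refine HasCompactSupport.intro (K := Set.Icc (-R) R) isCompact_Icc fun x hx => ?_
    rcases le_or_gt x (-R) with h | h
    · rw [intervalIntegral.integral_symm, intervalIntegral.integral_of_le h,
        setIntegral_eq_zero_of_forall_eq_zero, neg_zero]
      exact fun t ht => hR t fun h' => not_le.2 h'.1 ht.2
    · have hx' : R < x := by
        by_contra h'
        exact hx ⟨h.le, not_lt.1 h'⟩
      rw [intervalIntegral.integral_of_le h.le, setIntegral_eq_integral_of_forall_compl_eq_zero, h0]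
      exact fun t ht => hR t fun h' => ht ⟨h'.1, h'.2.le.trans hx'.le⟩

lemma exists_testFunction_integral_eq_one :
    ∃ ρ : ℝ → ℝ, ContDiff ℝ ∞ ρ ∧ HasCompactSupport ρ ∧ ∫ x, ρ x = 1 := by
  let f : ContDiffBump (0 : ℝ) := ⟨1, 2, one_pos, one_lt_two⟩
  exact ⟨f.normed volume, f.contDiff_normed, f.hasCompactSupport_normed, f.integral_normed⟩

/-- A locally integrable function with vanishing weak derivative is constant. -/
lemma ae_const_of_integral_deriv_smul_eq_zero {E : Type*} [NormedAddCommGroup E] [NormedSpace ℝ E]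
    [CompleteSpace E] {w : ℝ → E} (hw : LocallyIntegrable w volume)
    (h : ∀ ψ : ℝ → ℝ, ContDiff ℝ ∞ ψ → HasCompactSupport ψ → ∫ x, deriv ψ x • w x = 0) :
    ∃ c : E, ∀ᵐ x, w x = c := by
  obtain ⟨ρ, hρ, hρc, hρ1⟩ := exists_testFunction_integral_eq_one
  refine ⟨∫ x, ρ x • w x, ?_⟩
  refine ae_eq_of_integral_contDiff_smul_eq hw (locallyIntegrable_const _) fun φ hφ hφc => ?_
  set a := ∫ x, φ x with ha
  have hi1 : Integrable φ := hφ.continuous.integrable_of_hasCompactSupport hφc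
  have hi2 : Integrable ρ := hρ.continuous.integrable_of_hasCompactSupport hρc
  obtain ⟨ψ, hψ, hψc, hψ'⟩ := exists_primitive_hasCompactSupport
    (θ := fun x => φ x - a * ρ x) (hφ.sub (contDiff_const.mul hρ))
    (hφc.sub (hρc.mul_left (f := fun _ => a)))
    (by rw [integral_sub hi1 (hi2.const_mul a), integral_const_mul, hρ1, mul_one, sub_self])
  have h1 := h ψ hψ hψc
  rw [hψ'] at h1
  have hj1 : Integrable fun x => φ x • w x :=
    hw.integrable_smul_left_of_hasCompactSupport hφ.continuous hφc
  have hj2 : Integrable fun x => ρ x • w x :=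
    hw.integrable_smul_left_of_hasCompactSupport hρ.continuous hρc
  simp only [sub_smul, mul_smul] at h1
  rw [integral_sub hj1 (hj2.fun_smul a), integral_smul, sub_eq_zero] at h1
  rw [h1, integral_smul_const]

/-- Integration by parts against the primitive of a locally integrable function. -/
lemma integral_deriv_smul_primitive {E : Type*} [NormedAddCommGroup E] [NormedSpace ℝ E]
    [CompleteSpace E] {g : ℝ → E} (hg : LocallyIntegrable g volume) {ψ : ℝ → ℝ}
    (hψ : ContDiff ℝ ∞ ψ) (hc : HasCompactSupport ψ) :
    ∫ x, deriv ψ x • (∫ t in (0 : ℝ)..x, g t) = -∫ x, ψ x • g x := by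
  obtain ⟨R, hR0, hR⟩ := exists_Ioo_support hc
  have hd : Continuous (deriv ψ) := hψ.continuous_deriv (by norm_num)
  have hR' : ∀ x, x ∉ Set.Icc (-R) R → deriv ψ x = 0 := fun x hx => by
    have : ψ =ᶠ[𝓝 x] fun _ => 0 := by
      filter_upwards [isClosed_Icc.isOpen_compl.mem_nhds hx] with y hy
      exact hR y fun h' => hy (Set.Ioo_subset_Icc_self h')
    rw [this.deriv_eq, deriv_const]
  set k : ℝ → E := (Set.Ioc (-R) R).indicator g with hk
  have hki : Integrable k := by
    rw [hk, integrable_indicator_iff measurableSet_Ioc]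
    exact (hg.integrableOn_isCompact isCompact_Icc).mono_set Set.Ioc_subset_Icc_self
  have hdi : Integrable (deriv ψ) := hd.integrable_of_hasCompactSupport hc.deriv
  have hint (a b : ℝ) : IntervalIntegrable g volume a b :=
    (hg.integrableOn_isCompact isCompact_uIcc).intervalIntegrable
  -- Fubini on the half plane `t ≤ x`
  have hF : Integrable (Function.uncurry fun x t : ℝ =>
      (Set.Iic x).indicator (fun t => deriv ψ x • k t) t) (volume.prod volume) := by
    have h1 : Integrable (fun z : ℝ × ℝ => deriv ψ z.1 • k z.2) (volume.prod volume) :=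
      hdi.smul_prod hki
    have h2 : MeasurableSet {z : ℝ × ℝ | z.2 ≤ z.1} := measurableSet_le measurable_snd measurable_fst
    refine (h1.indicator h2).congr (Eventually.of_forall fun z => ?_)
    simp only [Function.uncurry, Set.indicator, Set.mem_ofPred_eq, Set.mem_Iic]
  have h3 := integral_integral_swap hF
  have hL : ∀ x, deriv ψ x • (∫ t in (0 : ℝ)..x, g t) =
      (∫ t, (Set.Iic x).indicator (fun t => deriv ψ x • k t) t)
        - deriv ψ x • ∫ t in (-R)..0, g t := by
    intro x
    by_cases hx : x ∈ Set.Icc (-R) R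
    · rw [integral_indicator measurableSet_Iic, integral_smul, ← smul_sub, hk,
        setIntegral_indicator measurableSet_Ioc]
      have : Set.Iic x ∩ Set.Ioc (-R) R = Set.Ioc (-R) x := by
        ext t
        simp only [Set.mem_inter_iff, Set.mem_Iic, Set.mem_Ioc]
        exact ⟨fun h => ⟨h.2.1, h.1⟩, fun h => ⟨h.2, h.1, h.2.trans hx.2⟩⟩
      rw [this, ← intervalIntegral.integral_of_le hx.1,
        intervalIntegral.integral_interval_sub_left (hint _ _) (hint _ _)]
    · simp [hR' x hx]
  have hRt : ∀ t, (∫ x, (Set.Iic x).indicator (fun t => deriv ψ x • k t) t) = -(ψ t • k t) := by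
    intro t
    have : ∀ x, (Set.Iic x).indicator (fun t => deriv ψ x • k t) t =
        (Set.Ici t).indicator (fun x => deriv ψ x • k t) x := fun x => by
      simp only [Set.indicator, Set.mem_Iic, Set.mem_Ici]
    simp_rw [this]
    rw [integral_indicator measurableSet_Ici, integral_smul_const, integral_Ici_eq_integral_Ioi,
      HasCompactSupport.integral_Ioi_deriv_eq (hψ.of_le (by norm_num)) hc, neg_smul]
  have hz : ∫ x, deriv ψ x = 0 := integral_eq_zero_of_hasDerivAt_of_integrable
    (fun x => (hψ.differentiable (by norm_num) x).hasDerivAt) hdi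
    (hψ.continuous.integrable_of_hasCompactSupport hc)
  simp_rw [hL]
  have h4 : Integrable fun x => ∫ t, (Set.Iic x).indicator (fun t => deriv ψ x • k t) t :=
    hF.integral_prod_left
  rw [integral_sub h4 (hdi.smul_const _), h3, integral_smul_const, hz, zero_smul,
    sub_zero]
  simp_rw [hRt]
  rw [integral_neg]
  congr 1
  refine integral_congr_ae (Eventually.of_forall fun t => ?_)
  by_cases hx : t ∈ Set.Ioc (-R) R
  · simp [hk, hx]
  · simp [hR t fun h' => hx (Set.Ioo_subset_Ioc_self h')]

/-- An `H¹` function is, up to a constant, the primitive of its weak derivative. -/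
lemma HasWeakDeriv.ae_eq_primitive {𝕜 : Type*} [RCLike 𝕜] {u g : L2 𝕜} (h : HasWeakDeriv u g) :
    ∃ c : 𝕜, ∀ᵐ x, u x = (∫ t in (0 : ℝ)..x, g t) + c := by
  have hg := locallyIntegrable_L2 g
  have hint (a b : ℝ) : IntervalIntegrable g volume a b :=
    (hg.integrableOn_isCompact isCompact_uIcc).intervalIntegrable
  have hG : Continuous fun x => ∫ t in (0 : ℝ)..x, g t :=
    intervalIntegral.continuous_primitive hint 0
  obtain ⟨c, hcc⟩ := ae_const_of_integral_deriv_smul_eq_zero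
    (w := fun x => u x - ∫ t in (0 : ℝ)..x, g t)
    ((locallyIntegrable_L2 u).sub hG.locallyIntegrable) (by
      intro ψ hψ hψc
      have hd : Continuous (deriv ψ) := hψ.continuous_deriv (by norm_num)
      simp_rw [smul_sub]
      rw [integral_sub (integrable_test_smul u hd hψc.deriv)
        (hG.locallyIntegrable.integrable_smul_left_of_hasCompactSupport hd hψc.deriv),
        integral_deriv_smul_primitive hg hψ hψc, h ψ hψ hψc, sub_self])
  exact ⟨c, hcc.mono fun x hx => by rw [← hx]; ring⟩

lemma norm_sq_eq_integral {𝕜 : Type*} [RCLike 𝕜] (u : L2 𝕜) : ‖u‖ ^ 2 = ∫ x, ‖u x‖ ^ 2 := by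
  rw [← inner_self_eq_norm_sq (𝕜 := 𝕜), L2.inner_def, ← integral_re (L2.integrable_inner u u)]
  simp only [inner_self_eq_norm_sq]

lemma integrable_norm_sq {𝕜 : Type*} [RCLike 𝕜] (u : L2 𝕜) : Integrable fun x => ‖u x‖ ^ 2 :=
  (memLp_two_iff_integrable_sq_norm (Lp.aestronglyMeasurable u)).1 (Lp.memLp u)

/-- The Cauchy–Schwarz inequality on an interval. -/
lemma norm_intervalIntegral_sq_le {𝕜 : Type*} [RCLike 𝕜] (g : L2 𝕜) (a b : ℝ) :
    ‖∫ t in a..b, g t‖ ^ 2 ≤ |b - a| * ‖g‖ ^ 2 := by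
  set s := Set.uIoc a b
  have hs : volume s ≠ ⊤ := by simp [s, Set.uIoc]
  have hvol : volume.real s = |b - a| := by
    simp only [s, Set.uIoc, Measure.real, Real.volume_Ioc, max_sub_min_eq_abs']
    rw [ENNReal.toReal_ofReal (abs_nonneg _), abs_sub_comm]
  have h1 : ‖∫ t in a..b, g t‖ = ‖∫ t in s, g t‖ := intervalIntegral.norm_integral_eq_norm_integral_uIoc _
  have h2 : ∫ t in s, g t = ⟪indicatorConstLp 2 measurableSet_uIoc hs (1 : 𝕜), g⟫_𝕜 :=
    (L2.inner_indicatorConstLp_one measurableSet_uIoc hs g).symm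
  have h3 : ‖indicatorConstLp 2 (measurableSet_uIoc (a := a) (b := b)) hs (1 : 𝕜)‖ ^ 2 = |b - a| := by
    rw [norm_indicatorConstLp two_ne_zero ENNReal.ofNat_ne_top, hvol, norm_one, one_mul,
      ← Real.rpow_natCast, ← Real.rpow_mul (abs_nonneg _)]
    norm_num
  rw [h1, h2, ← h3, ← mul_pow]
  exact pow_le_pow_left₀ (norm_nonneg _) (norm_inner_le_norm _ _) 2

/-- If `x` has distance at most `L` to the points of an interval of length `s`, then `|u x|²` is
bounded by the mean of `|u|²` over that interval and by the derivative of `u`. -/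
lemma HasWeakDeriv.norm_sq_le {𝕜 : Type*} [RCLike 𝕜] {u g : L2 𝕜} (h : HasWeakDeriv u g) :
    ∀ᵐ x, ∀ p s L : ℝ, 0 < s → (∀ y ∈ Set.Ioc p (p + s), |x - y| ≤ L) →
      ‖u x‖ ^ 2 ≤ 2 / s * (∫ y in Set.Ioc p (p + s), ‖u y‖ ^ 2) + 2 * L * ‖g‖ ^ 2 := by
  obtain ⟨c, hc⟩ := h.ae_eq_primitive
  have hint (a b : ℝ) : IntervalIntegrable g volume a b :=
    ((locallyIntegrable_L2 g).integrableOn_isCompact isCompact_uIcc).intervalIntegrable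
  filter_upwards [hc] with x hx p s L hs hL
  have hpt : ∀ᵐ y ∂volume.restrict (Set.Ioc p (p + s)),
      ‖u x‖ ^ 2 ≤ 2 * ‖u y‖ ^ 2 + 2 * L * ‖g‖ ^ 2 := by
    filter_upwards [ae_restrict_of_ae hc, ae_restrict_mem measurableSet_Ioc] with y hy hyI
    have h1 : u x - u y = ∫ t in y..x, g t := by
      rw [hx, hy, ← intervalIntegral.integral_interval_sub_left (hint 0 x) (hint 0 y)]
      ring
    have h2 : ‖u x - u y‖ ^ 2 ≤ L * ‖g‖ ^ 2 := by
      rw [h1]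
      exact (norm_intervalIntegral_sq_le g y x).trans
        (mul_le_mul_of_nonneg_right (hL y hyI) (by positivity))
    have h3 : ‖u x‖ ≤ ‖u y‖ + ‖u x - u y‖ := norm_le_norm_add_norm_sub' _ _
    nlinarith [norm_nonneg (u x), sq_nonneg (‖u y‖ - ‖u x - u y‖)]
  have hint2 : IntegrableOn (fun y => ‖u y‖ ^ 2) (Set.Ioc p (p + s)) :=
    (integrable_norm_sq u).integrableOn
  have hvol : volume.real (Set.Ioc p (p + s)) = s := by
    simp [Measure.real, hs.le]
  have h4 := integral_mono_ae (μ := volume.restrict (Set.Ioc p (p + s)))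
    (f := fun _ => ‖u x‖ ^ 2) (integrable_const _)
    ((hint2.const_mul 2).add (integrable_const (2 * L * ‖g‖ ^ 2))) hpt
  simp only [Pi.add_apply] at h4
  rw [integral_add (hint2.const_mul 2) (integrable_const _), integral_const_mul, integral_const,
    integral_const, measureReal_restrict_apply_univ, hvol, smul_eq_mul, smul_eq_mul] at h4
  rw [div_mul_eq_mul_div, ← sub_le_iff_le_add, le_div_iff₀ hs]
  linarith

/-- The Sobolev inequality at length scale `s`. -/
lemma HasWeakDeriv.norm_sq_le_sobolev {𝕜 : Type*} [RCLike 𝕜] {u g : L2 𝕜} (h : HasWeakDeriv u g)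
    {s : ℝ} (hs : 0 < s) :
    ∀ᵐ x, ‖u x‖ ^ 2 ≤ 2 / s * ‖u‖ ^ 2 + 2 * s * ‖g‖ ^ 2 := by
  filter_upwards [h.norm_sq_le] with x hx
  refine (hx x s s hs fun y hy => ?_).trans ?_
  · rw [abs_le]
    constructor <;> linarith [hy.1, hy.2]
  · rw [norm_sq_eq_integral u]
    gcongr
    · exact Eventually.of_forall fun y => by positivity
    · exact integrable_norm_sq u
    · exact Measure.restrict_le_self

/-! ### Multiplication by bounded functions -/

/-- Multiplication of an `L²` function by an essentially bounded real function. -/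
noncomputable def bddMul {𝕜 : Type*} [RCLike 𝕜] {φ : ℝ → ℝ} (hφ : MemLp φ ⊤ volume)
    (u : L2 𝕜) : L2 𝕜 :=
  MemLp.toLp (fun x => φ x • u x) ((Lp.memLp u).smul hφ)

section bddMul

variable {𝕜 : Type*} [RCLike 𝕜] {φ : ℝ → ℝ} (hφ : MemLp φ ⊤ volume)

lemma coeFn_bddMul (u : L2 𝕜) : bddMul hφ u =ᵐ[volume] fun x => φ x • u x :=
  MemLp.coeFn_toLp _

lemma norm_bddMul_le {B : ℝ} (hB : ∀ x, |φ x| ≤ B) (u : L2 𝕜) : ‖bddMul hφ u‖ ≤ B * ‖u‖ := by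
  refine Lp.norm_le_mul_norm_of_ae_le_mul ?_
  filter_upwards [coeFn_bddMul hφ u] with x hx
  rw [hx, norm_smul]
  exact mul_le_mul_of_nonneg_right (hB x) (norm_nonneg _)

lemma inner_bddMul_left (u v : L2 𝕜) : ⟪bddMul hφ u, v⟫_𝕜 = ⟪u, bddMul hφ v⟫_𝕜 := by
  rw [L2.inner_def, L2.inner_def]
  refine integral_congr_ae ?_
  filter_upwards [coeFn_bddMul hφ u, coeFn_bddMul hφ v] with x h1 h2
  rw [h1, h2, inner_smul_left_eq_smul, inner_smul_right_eq_smul]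

end bddMul

lemma memLp_top_of_hasCompactSupport {φ : ℝ → ℝ} (hφ : Continuous φ) (hc : HasCompactSupport φ) :
    MemLp φ ⊤ volume :=
  hφ.memLp_top_of_hasCompactSupport hc volume

/-- The product rule for the weak derivative. -/
lemma HasWeakDeriv.bddMul {𝕜 : Type*} [RCLike 𝕜] {u g : L2 𝕜} (h : HasWeakDeriv u g)
    {χ : ℝ → ℝ} (hχ : ContDiff ℝ ∞ χ) (h0 : MemLp χ ⊤ volume)
    (h1 : MemLp (deriv χ) ⊤ volume) :
    HasWeakDeriv (ThinStrip.bddMul h0 u) (ThinStrip.bddMul h1 u + ThinStrip.bddMul h0 g) := by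
  intro φ hφ hc
  have hφd : Continuous (deriv φ) := hφ.continuous_deriv (by norm_num)
  have hχd : Continuous (deriv χ) := hχ.continuous_deriv (by norm_num)
  have key := h (fun x => φ x * χ x) (hφ.mul hχ) hc.mul_right
  have hd : ∀ x, deriv (fun x => φ x * χ x) x = deriv φ x * χ x + φ x * deriv χ x := fun x =>
    deriv_fun_mul (hφ.differentiable (by norm_num) x) (hχ.differentiable (by norm_num) x)
  simp_rw [hd, add_smul] at key
  have i1 : Integrable fun x => (deriv φ x * χ x) • u x :=
    integrable_test_smul u (hφd.mul hχ.continuous) hc.deriv.mul_right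
  have i2 : Integrable fun x => (φ x * deriv χ x) • u x :=
    integrable_test_smul u (hφ.continuous.mul hχd) hc.mul_right
  rw [integral_add i1 i2] at key
  rw [integral_test_add _ _ hφ.continuous hc]
  have e1 : ∫ x, deriv φ x • ThinStrip.bddMul h0 u x = ∫ x, (deriv φ x * χ x) • u x := by
    refine integral_congr_ae ?_
    filter_upwards [coeFn_bddMul h0 u] with x hx
    rw [hx, mul_smul]
  have e2 : ∫ x, φ x • ThinStrip.bddMul h1 u x = ∫ x, (φ x * deriv χ x) • u x := by
    refine integral_congr_ae ?_
    filter_upwards [coeFn_bddMul h1 u] with x hx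
    rw [hx, mul_smul]
  have e3 : ∫ x, φ x • ThinStrip.bddMul h0 g x = ∫ x, (φ x * χ x) • g x := by
    refine integral_congr_ae ?_
    filter_upwards [coeFn_bddMul h0 g] with x hx
    rw [hx, mul_smul]
  rw [e1, e2, e3, neg_add, ← key]
  ring

lemma weakDeriv_mk_eq {𝕜 : Type*} [RCLike 𝕜] {u g : L2 𝕜} (h : HasWeakDeriv u g)
    (hu : u ∈ (weakDeriv 𝕜).domain) : weakDeriv 𝕜 ⟨u, hu⟩ = g := by
  have h1 : (u, weakDeriv 𝕜 ⟨u, hu⟩) ∈ weakDerivGraph 𝕜 := hasWeakDeriv_weakDeriv ⟨u, hu⟩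
  have h2 : (u, g) ∈ weakDerivGraph 𝕜 := h
  have h3 := weakDerivGraph_functional 𝕜 _ ((weakDerivGraph 𝕜).sub_mem h1 h2) (sub_self u)
  exact sub_eq_zero.1 h3

/-! ### The two parts of the form -/

section parts

variable {𝕜 : Type*} [RCLike 𝕜] {V : ℝ → ℝ}

/-- The weak derivative of an element of the form domain. -/
noncomputable def gradPart (u : formDomain 𝕜 V) : L2 𝕜 :=
  weakDeriv 𝕜 ⟨u, formDomain.mem_deriv u.2⟩

/-- The function `√V u`, for an element `u` of the form domain. -/
noncomputable def potPart (u : formDomain 𝕜 V) : L2 𝕜 :=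
  mulOp 𝕜 (fun x => √(V x)) ⟨u, formDomain.mem_mul u.2⟩

/-- The value `∫ (|u'|² + V |u|²)` of the quadratic form. -/
noncomputable def energy (u : formDomain 𝕜 V) : ℝ := ‖gradPart u‖ ^ 2 + ‖potPart u‖ ^ 2

lemma form_eq_inner (u v : formDomain 𝕜 V) :
    form V u v = ⟪gradPart u, gradPart v⟫_𝕜 + ⟪potPart u, potPart v⟫_𝕜 := rfl

lemma form_self (u : formDomain 𝕜 V) : form V u u = (energy u : 𝕜) := by
  rw [form_eq_inner, inner_self_eq_norm_sq_to_K, inner_self_eq_norm_sq_to_K, energy]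
  push_cast
  rfl

lemma conj_form (u v : formDomain 𝕜 V) : conj (form V u v) = form V v u := by
  rw [form_eq_inner, form_eq_inner, map_add, inner_conj_symm, inner_conj_symm]

lemma hasWeakDeriv_gradPart (u : formDomain 𝕜 V) : HasWeakDeriv (u : L2 𝕜) (gradPart u) :=
  hasWeakDeriv_weakDeriv (⟨(u : L2 𝕜), formDomain.mem_deriv u.2⟩ : (weakDeriv 𝕜).domain)

lemma coeFn_potPart (u : formDomain 𝕜 V) :
    potPart u =ᵐ[volume] fun x => ((√(V x) : ℝ) : 𝕜) * (u : L2 𝕜) x :=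
  MemLp.coeFn_toLp (formDomain.mem_mul u.2)

lemma gradPart_eq {u : formDomain 𝕜 V} {g : L2 𝕜} (h : HasWeakDeriv (u : L2 𝕜) g) :
    gradPart u = g :=
  weakDeriv_mk_eq h _

lemma potPart_eq {u : formDomain 𝕜 V} {w : L2 𝕜}
    (h : w =ᵐ[volume] fun x => ((√(V x) : ℝ) : 𝕜) * (u : L2 𝕜) x) : potPart u = w :=
  Lp.ext ((coeFn_potPart u).trans h.symm)

lemma norm_potPart_sq_ae (hV : ∀ x, 0 ≤ V x) (u : formDomain 𝕜 V) :
    ∀ᵐ x, ‖potPart u x‖ ^ 2 = V x * ‖(u : L2 𝕜) x‖ ^ 2 := by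
  filter_upwards [coeFn_potPart u] with x hx
  rw [hx, norm_mul, mul_pow, RCLike.norm_ofReal, sq_abs, Real.sq_sqrt (hV x)]

lemma mem_formDomain_of {u g w : L2 𝕜} (h : HasWeakDeriv u g)
    (hw : w =ᵐ[volume] fun x => ((√(V x) : ℝ) : 𝕜) * u x) : u ∈ formDomain 𝕜 V :=
  ⟨(mem_weakDeriv_domain_iff u).2 ⟨g, h⟩, (memLp_congr_ae hw).1 (Lp.memLp w)⟩

/-- A locally integrable potential does not restrict bounded functions of compact support. -/
lemma memLp_sqrt_mul (hV : ∀ x, 0 ≤ V x) (hVi : LocallyIntegrable V volume) {u : ℝ → 𝕜}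
    {χ : ℝ → ℝ} (hχ : Continuous χ) (hc : HasCompactSupport χ) {C : ℝ}
    (hu : AEStronglyMeasurable u volume) (hb : ∀ᵐ x, ‖u x‖ ≤ C * |χ x|) :
    MemLp (fun x => ((√(V x) : ℝ) : 𝕜) * u x) 2 volume := by
  have hm : AEStronglyMeasurable (fun x => ((√(V x) : ℝ) : 𝕜) * u x) volume :=
    (RCLike.continuous_ofReal.comp_aestronglyMeasurable
      (Real.continuous_sqrt.comp_aestronglyMeasurable hVi.aestronglyMeasurable)).mul hu
  rw [memLp_two_iff_integrable_sq_norm hm]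
  have hi : Integrable (fun x => (C * χ x) ^ 2 * V x) := by
    have hc' : HasCompactSupport fun x => (C * χ x) ^ 2 :=
      hc.comp_left (g := fun t => (C * t) ^ 2) (by simp)
    simpa using hVi.integrable_smul_left_of_hasCompactSupport
      (f := V) (g := fun x => (C * χ x) ^ 2) (by fun_prop) hc'
  refine hi.mono' (hm.norm.pow 2) ?_
  filter_upwards [hb] with x hx
  rw [Real.norm_of_nonneg (by positivity), norm_mul, mul_pow, RCLike.norm_ofReal, sq_abs,
    Real.sq_sqrt (hV x), mul_comm]
  refine mul_le_mul_of_nonneg_right ?_ (hV x)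
  rw [mul_pow, ← sq_abs (χ x), ← mul_pow]
  exact pow_le_pow_left₀ (norm_nonneg _) hx 2

/-- Cutting off an `H¹` function leads into the form domain of every locally integrable
potential. -/
lemma bddMul_mem_formDomain (hV : ∀ x, 0 ≤ V x) (hVi : LocallyIntegrable V volume)
    {u g : L2 𝕜} (h : HasWeakDeriv u g) {χ : ℝ → ℝ} (hχ : ContDiff ℝ ∞ χ)
    (hc : HasCompactSupport χ) (h0 : MemLp χ ⊤ volume) : bddMul h0 u ∈ formDomain 𝕜 V := by
  have h1 := memLp_top_of_hasCompactSupport (hχ.continuous_deriv (by norm_num)) hc.deriv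
  refine ⟨(mem_weakDeriv_domain_iff _).2 ⟨_, h.bddMul hχ h0 h1⟩, ?_⟩
  refine memLp_sqrt_mul (C := √(2 / 1 * ‖u‖ ^ 2 + 2 * 1 * ‖g‖ ^ 2)) hV hVi hχ.continuous hc
    (Lp.aestronglyMeasurable _) ?_
  filter_upwards [coeFn_bddMul h0 u, h.norm_sq_le_sobolev one_pos] with x hx hs
  rw [hx, norm_smul, mul_comm, Real.norm_eq_abs]
  exact mul_le_mul_of_nonneg_right (Real.le_sqrt_of_sq_le hs) (abs_nonneg _)

lemma hasWeakDeriv_of_contDiff {f : ℝ → 𝕜} (hf : ContDiff ℝ ∞ f) {u g : L2 𝕜}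
    (hu : u =ᵐ[volume] f) (hg : g =ᵐ[volume] deriv f) : HasWeakDeriv u g := by
  intro φ hφ hc
  have hfd : Continuous (deriv f) := hf.continuous_deriv (by norm_num)
  have hφd : Continuous (deriv φ) := hφ.continuous_deriv (by norm_num)
  have e1 : ∫ x, deriv φ x • u x = ∫ x, deriv φ x • f x :=
    integral_congr_ae (hu.mono fun x hx => by simp only [hx])
  have e2 : ∫ x, φ x • g x = ∫ x, φ x • deriv f x :=
    integral_congr_ae (hg.mono fun x hx => by simp only [hx])
  have i1 : Integrable fun x => deriv φ x • f x :=
    (hφd.smul hf.continuous).integrable_of_hasCompactSupport hc.deriv.smul_right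
  have i2 : Integrable fun x => φ x • deriv f x :=
    (hφ.continuous.smul hfd).integrable_of_hasCompactSupport hc.smul_right
  have := integral_eq_zero_of_hasDerivAt_of_integrable
    (f := fun x => φ x • f x) (f' := fun x => φ x • deriv f x + deriv φ x • f x)
    (fun x => (hφ.differentiable (by norm_num) x).hasDerivAt.smul
      (hf.differentiable (by norm_num) x).hasDerivAt) (i2.add i1)
    ((hφ.continuous.smul hf.continuous).integrable_of_hasCompactSupport hc.smul_right)
  rw [integral_add i2 i1] at this
  rw [e1, e2, eq_neg_iff_add_eq_zero, add_comm, this]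

/-- For a locally integrable potential the form domain contains all test functions. -/
lemma dense_formDomain (hV : ∀ x, 0 ≤ V x) (hVi : LocallyIntegrable V volume) :
    Dense (formDomain 𝕜 V : Set (L2 𝕜)) := by
  refine (Lp.dense_hasCompactSupport_contDiff (F := 𝕜) (μ := (volume : Measure ℝ)) (p := 2)
    ENNReal.ofNat_ne_top).mono ?_
  rintro u ⟨f, huf, hfc, hf⟩
  have hfd : Continuous (deriv f) := hf.continuous_deriv (by norm_num)
  have hm : MemLp (deriv f) 2 volume := hfd.memLp_of_hasCompactSupport hfc.deriv
  refine ⟨(mem_weakDeriv_domain_iff _).2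
    ⟨hm.toLp, hasWeakDeriv_of_contDiff hf huf hm.coeFn_toLp⟩, ?_⟩
  refine memLp_sqrt_mul (C := 1) (χ := fun x => ‖f x‖) hV hVi hf.continuous.norm hfc.norm
    (Lp.aestronglyMeasurable _) ?_
  filter_upwards [huf] with x hx
  simp [hx]

/-- The form is coercive when the potential is bounded below outside a compact set. -/
lemma norm_sq_le_energy (hV : ∀ x, 0 ≤ V x) {a κ : ℝ} (ha : 0 < a) (hκ : 0 < κ)
    (hVκ : ∀ x, a ≤ |x| → κ ≤ V x) (u : formDomain 𝕜 V) :
    ‖(u : L2 𝕜)‖ ^ 2 ≤ (5 / κ + 12 * a ^ 2) * energy u := by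
  have hint := integrable_norm_sq (u : L2 𝕜)
  have hintP := integrable_norm_sq (potPart u)
  -- where `a ≤ |x|`, the potential controls `u`
  have hpot : ∀ᵐ x, a ≤ |x| → ‖(u : L2 𝕜) x‖ ^ 2 ≤ 1 / κ * ‖potPart u x‖ ^ 2 := by
    filter_upwards [norm_potPart_sq_ae hV u] with x hx hax
    rw [hx, one_div, ← div_eq_inv_mul, le_div_iff₀ hκ, mul_comm]
    exact mul_le_mul_of_nonneg_right (hVκ x hax) (by positivity)
  have houter : ∀ s : Set ℝ, MeasurableSet s → (∀ x ∈ s, a ≤ |x|) →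
      ∫ x in s, ‖(u : L2 𝕜) x‖ ^ 2 ≤ 1 / κ * ‖potPart u‖ ^ 2 := by
    intro s hs has
    calc ∫ x in s, ‖(u : L2 𝕜) x‖ ^ 2 ≤ ∫ x in s, 1 / κ * ‖potPart u x‖ ^ 2 := by
          refine setIntegral_mono_on_ae hint.integrableOn (hintP.const_mul _).integrableOn hs ?_
          filter_upwards [hpot] with x hx hxs using hx (has x hxs)
      _ ≤ ∫ x, 1 / κ * ‖potPart u x‖ ^ 2 :=
          setIntegral_le_integral (hintP.const_mul _) (Eventually.of_forall fun x => by positivity)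
      _ = 1 / κ * ‖potPart u‖ ^ 2 := by rw [integral_const_mul, ← norm_sq_eq_integral]
  -- where `|x| < a`, compare with the interval `(a, 2a]`
  have hinner : ∫ x in Set.Ioo (-a) a, ‖(u : L2 𝕜) x‖ ^ 2 ≤
      2 * a * (2 / a * (1 / κ * ‖potPart u‖ ^ 2) + 2 * (3 * a) * ‖gradPart u‖ ^ 2) := by
    have h1 : ∀ᵐ x, x ∈ Set.Ioo (-a) a → ‖(u : L2 𝕜) x‖ ^ 2 ≤
        2 / a * (1 / κ * ‖potPart u‖ ^ 2) + 2 * (3 * a) * ‖gradPart u‖ ^ 2 := by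
      filter_upwards [(hasWeakDeriv_gradPart u).norm_sq_le] with x hx hxI
      refine (hx a a (3 * a) ha fun y hy => ?_).trans ?_
      · rw [abs_le]
        constructor <;> linarith [hy.1, hy.2, hxI.1, hxI.2]
      · gcongr
        exact houter _ measurableSet_Ioc fun y hy => hy.1.le.trans (le_abs_self y)
    refine (setIntegral_mono_on_ae hint.integrableOn (integrableOn_const (by simp))
      measurableSet_Ioo h1).trans (le_of_eq ?_)
    rw [setIntegral_const, smul_eq_mul, Real.volume_real_Ioo_of_le (by linarith)]
    ring
  have hsplit := integral_add_compl (μ := volume) (measurableSet_Ioo (a := -a) (b := a)) hint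
  have h2 := houter (Set.Ioo (-a) a)ᶜ measurableSet_Ioo.compl fun x hx => by
    by_contra h
    exact hx (abs_lt.1 (not_le.1 h))
  rw [norm_sq_eq_integral, ← hsplit, energy]
  have h3 : 2 * a * (2 / a * (1 / κ * ‖potPart u‖ ^ 2) + 2 * (3 * a) * ‖gradPart u‖ ^ 2) =
      4 / κ * ‖potPart u‖ ^ 2 + 12 * a ^ 2 * ‖gradPart u‖ ^ 2 := by
    field_simp
    ring
  rw [h3] at hinner
  have h4 : 0 ≤ 5 / κ * ‖gradPart u‖ ^ 2 := by positivity
  have h5 : 0 ≤ 12 * a ^ 2 * ‖potPart u‖ ^ 2 := by positivity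
  have h7 : 4 / κ * ‖potPart u‖ ^ 2 + 1 / κ * ‖potPart u‖ ^ 2 = 5 / κ * ‖potPart u‖ ^ 2 := by ring
  nlinarith

end parts

/-! ### The inverse of a coercive Schrödinger operator -/

section inverse

variable {𝕜 : Type*} [RCLike 𝕜]

lemma isClosed_weakDerivGraph : IsClosed (weakDerivGraph 𝕜 : Set (L2 𝕜 × L2 𝕜)) := by
  have hcont : ∀ φ : ℝ → ℝ, Continuous φ → HasCompactSupport φ →
      Continuous fun u : L2 𝕜 => ∫ x, φ x • u x := by
    intro φ hφ hc
    have hm : MemLp (fun x => (φ x : 𝕜)) 2 volume :=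
      (RCLike.continuous_ofReal.comp hφ).memLp_of_hasCompactSupport
        (hc.comp_left (g := fun t : ℝ => (t : 𝕜)) (by simp))
    have : (fun u : L2 𝕜 => ∫ x, φ x • u x) = fun u => ⟪hm.toLp, u⟫_𝕜 := by
      funext u
      rw [L2.inner_def]
      refine integral_congr_ae ?_
      filter_upwards [hm.coeFn_toLp] with x hx
      rw [hx, RCLike.inner_apply, RCLike.conj_ofReal, RCLike.real_smul_eq_coe_mul, mul_comm]
    rw [this]
    exact continuous_const.inner continuous_id
  have : (weakDerivGraph 𝕜 : Set (L2 𝕜 × L2 𝕜)) = ⋂ (φ : ℝ → ℝ) (_ : ContDiff ℝ ∞ φ)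
      (_ : HasCompactSupport φ), {p | ∫ x, deriv φ x • p.1 x = -∫ x, φ x • p.2 x} := by
    ext p
    simp only [Set.mem_iInter]
    rfl
  rw [this]
  refine isClosed_iInter fun φ => isClosed_iInter fun hφ => isClosed_iInter fun hc => ?_
  exact isClosed_eq ((hcont _ (hφ.continuous_deriv (by norm_num)) hc.deriv).comp continuous_fst)
    ((hcont _ hφ.continuous hc).comp continuous_snd).neg

lemma mem_mulOp_graph_iff {w : ℝ → ℝ} {p : L2 𝕜 × L2 𝕜} :
    p ∈ (mulOp 𝕜 w).graph ↔ p.2 =ᵐ[volume] fun x => (w x : 𝕜) * p.1 x := by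
  rw [LinearPMap.mem_graph_iff]
  constructor
  · rintro ⟨u, h1, h2⟩
    rw [← h1, ← h2]
    exact MemLp.coeFn_toLp u.2
  · intro h
    have hm : MemLp (fun x => (w x : 𝕜) * p.1 x) 2 volume := (memLp_congr_ae h).1 (Lp.memLp _)
    exact ⟨⟨p.1, hm⟩, rfl, Lp.ext ((MemLp.coeFn_toLp hm).trans h.symm)⟩

lemma isClosed_mulOp_graph (w : ℝ → ℝ) :
    IsClosed ((mulOp 𝕜 w).graph : Set (L2 𝕜 × L2 𝕜)) := by
  refine IsSeqClosed.isClosed fun p q hp hpq => ?_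
  have h1 := (continuous_fst.tendsto q).comp hpq
  have h2 := (continuous_snd.tendsto q).comp hpq
  -- along a subsequence both components converge almost everywhere
  obtain ⟨ns, hns, hae1⟩ := (tendstoInMeasure_of_tendsto_Lp h1).exists_seq_tendsto_ae
  obtain ⟨ms, hms, hae2⟩ :=
    (tendstoInMeasure_of_tendsto_Lp (h2.comp hns.tendsto_atTop)).exists_seq_tendsto_ae
  rw [SetLike.mem_coe, mem_mulOp_graph_iff]
  have hall : ∀ᵐ x, ∀ n, (p n).2 x = (w x : 𝕜) * (p n).1 x :=
    ae_all_iff.2 fun n => mem_mulOp_graph_iff.1 (hp n)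
  filter_upwards [hae1, hae2, hall] with x hx1 hx2 hx
  refine tendsto_nhds_unique hx2 (Tendsto.congr (fun n => (hx _).symm) ?_)
  exact (hx1.comp hms.tendsto_atTop).const_mul _

/-- The Hilbert space of triples `(u, u', √V u)` with `u` in the form domain. -/
noncomputable def formGraph (𝕜 : Type*) [RCLike 𝕜] (V : ℝ → ℝ) :
    Submodule 𝕜 (WithLp 2 (L2 𝕜 × WithLp 2 (L2 𝕜 × L2 𝕜))) :=
  (weakDerivGraph 𝕜).comap ((WithLp.fstₗ 2 𝕜 (L2 𝕜) (WithLp 2 (L2 𝕜 × L2 𝕜))).prod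
      (WithLp.fstₗ 2 𝕜 (L2 𝕜) (L2 𝕜) ∘ₗ WithLp.sndₗ 2 𝕜 (L2 𝕜) (WithLp 2 (L2 𝕜 × L2 𝕜)))) ⊓
  (mulOp 𝕜 fun x => √(V x)).graph.comap
    ((WithLp.fstₗ 2 𝕜 (L2 𝕜) (WithLp 2 (L2 𝕜 × L2 𝕜))).prod
      (WithLp.sndₗ 2 𝕜 (L2 𝕜) (L2 𝕜) ∘ₗ WithLp.sndₗ 2 𝕜 (L2 𝕜) (WithLp 2 (L2 𝕜 × L2 𝕜))))

variable {V : ℝ → ℝ}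

lemma mem_formGraph {z : WithLp 2 (L2 𝕜 × WithLp 2 (L2 𝕜 × L2 𝕜))} :
    z ∈ formGraph 𝕜 V ↔
      HasWeakDeriv z.fst z.snd.fst ∧ (z.fst, z.snd.snd) ∈ (mulOp 𝕜 fun x => √(V x)).graph :=
  Iff.rfl

lemma isClosed_formGraph :
    IsClosed (formGraph 𝕜 V : Set (WithLp 2 (L2 𝕜 × WithLp 2 (L2 𝕜 × L2 𝕜)))) := by
  have h1 : Continuous fun z : WithLp 2 (L2 𝕜 × WithLp 2 (L2 𝕜 × L2 𝕜)) => z.fst :=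
    (WithLp.fstL 2 𝕜 _ _).continuous
  have h2 : Continuous fun z : WithLp 2 (L2 𝕜 × WithLp 2 (L2 𝕜 × L2 𝕜)) => z.snd :=
    (WithLp.sndL 2 𝕜 _ _).continuous
  have h3 : Continuous fun z : WithLp 2 (L2 𝕜 × L2 𝕜) => z.fst := (WithLp.fstL 2 𝕜 _ _).continuous
  have h4 : Continuous fun z : WithLp 2 (L2 𝕜 × L2 𝕜) => z.snd := (WithLp.sndL 2 𝕜 _ _).continuous
  exact (isClosed_weakDerivGraph.preimage (h1.prodMk (h3.comp h2))).inter
    ((isClosed_mulOp_graph _).preimage (h1.prodMk (h4.comp h2)))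

lemma mem_formDomain_of_mem_formGraph {z : WithLp 2 (L2 𝕜 × WithLp 2 (L2 𝕜 × L2 𝕜))}
    (hz : z ∈ formGraph 𝕜 V) : ∃ hu : z.fst ∈ formDomain 𝕜 V,
      gradPart ⟨z.fst, hu⟩ = z.snd.fst ∧ potPart ⟨z.fst, hu⟩ = z.snd.snd := by
  have h := mem_formGraph.1 hz
  have h2 := mem_mulOp_graph_iff.1 h.2
  exact ⟨mem_formDomain_of h.1 h2, gradPart_eq h.1, potPart_eq h2⟩

lemma toLp_mem_formGraph (v : formDomain 𝕜 V) :
    WithLp.toLp 2 ((v : L2 𝕜), WithLp.toLp 2 (gradPart v, potPart v)) ∈ formGraph 𝕜 V :=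
  mem_formGraph.2 ⟨hasWeakDeriv_gradPart v, mem_mulOp_graph_iff.2 (coeFn_potPart v)⟩

/-- Lax–Milgram for the form `⟪P z, P w⟫`: the solution operator is `(P† P)⁻¹ C†`. -/
lemma exists_lax_milgram {G K L : Type*} [NormedAddCommGroup G] [InnerProductSpace 𝕜 G]
    [CompleteSpace G] [NormedAddCommGroup K] [InnerProductSpace 𝕜 K] [CompleteSpace K]
    [NormedAddCommGroup L] [InnerProductSpace 𝕜 L] [CompleteSpace L] (P : G →L[𝕜] K)
    (C : G →L[𝕜] L) {c : ℝ} (hc : 0 < c) (h : ∀ z, ‖z‖ ^ 2 ≤ c * ‖P z‖ ^ 2) :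
    ∃ S : L →L[𝕜] G, ∀ f w, ⟪P (S f), P w⟫_𝕜 = ⟪f, C w⟫_𝕜 := by
  have hPP : ∀ z w, ⟪(P.adjoint ∘L P) z, w⟫_𝕜 = ⟪P z, P w⟫_𝕜 := fun z w =>
    ContinuousLinearMap.adjoint_inner_left P w (P z)
  have hunit : IsUnit (P.adjoint ∘L P) := by
    refine ContinuousLinearMap.isUnit_of_forall_le_norm_inner_map _
      (c := Real.toNNReal c⁻¹) (Real.toNNReal_pos.2 (by positivity)) fun z => ?_
    rw [hPP, inner_self_eq_norm_sq_to_K, norm_pow, RCLike.norm_ofReal, sq_abs,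
      Real.coe_toNNReal _ (by positivity), ← div_eq_mul_inv, div_le_iff₀ hc, mul_comm]
    exact h z
  obtain ⟨e, he⟩ := hunit
  refine ⟨(↑e⁻¹ : G →L[𝕜] G) ∘L C.adjoint, fun f w => ?_⟩
  have hez : (P.adjoint ∘L P) (((↑e⁻¹ : G →L[𝕜] G) ∘L C.adjoint) f) = C.adjoint f := by
    rw [← he, ContinuousLinearMap.comp_apply, ← mul_apply_eq_comp, e.mul_inv,
      one_apply_eq_self]
  rw [← hPP, hez, ContinuousLinearMap.adjoint_inner_left]

/-- Lax–Milgram for a form given by a closed relation between `u : X` and `D u : Y`. -/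
lemma exists_solution_of_isClosed_graph {X Y : Type*} [NormedAddCommGroup X]
    [InnerProductSpace 𝕜 X] [CompleteSpace X] [NormedAddCommGroup Y] [InnerProductSpace 𝕜 Y]
    [CompleteSpace Y] {S : Submodule 𝕜 (WithLp 2 (X × Y))}
    (hS : IsClosed (S : Set (WithLp 2 (X × Y)))) {c : ℝ} (hc : 0 < c)
    (h : ∀ z ∈ S, ‖z.fst‖ ^ 2 ≤ c * ‖z.snd‖ ^ 2) :
    ∃ T : X →L[𝕜] X, ∀ f, ∃ z ∈ S, z.fst = T f ∧
      ∀ w ∈ S, ⟪z.snd, w.snd⟫_𝕜 = ⟪f, w.fst⟫_𝕜 := by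
  have : CompleteSpace S := hS.completeSpace_coe
  obtain ⟨R, hR⟩ := exists_lax_milgram ((WithLp.sndL 2 𝕜 X Y) ∘L S.subtypeL)
    ((WithLp.fstL 2 𝕜 X Y) ∘L S.subtypeL) (c := c + 1) (by positivity) fun z => by
      have h1 : ‖z‖ ^ 2 = ‖(z : WithLp 2 (X × Y)).fst‖ ^ 2 + ‖(z : WithLp 2 (X × Y)).snd‖ ^ 2 :=
        WithLp.prod_norm_sq_eq_of_L2 (z : WithLp 2 (X × Y))
      have h2 := h z z.2
      change ‖z‖ ^ 2 ≤ (c + 1) * ‖(z : WithLp 2 (X × Y)).snd‖ ^ 2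
      linarith
  exact ⟨(WithLp.fstL 2 𝕜 X Y) ∘L S.subtypeL ∘L R, fun f => ⟨R f, (R f).2, rfl,
    fun w hw => hR f ⟨w, hw⟩⟩⟩

/-- A coercive form has a bounded solution operator. -/
theorem exists_form_solution {c : ℝ} (hc : 0 < c)
    (hco : ∀ u : formDomain 𝕜 V, ‖(u : L2 𝕜)‖ ^ 2 ≤ c * energy u) :
    ∃ T : L2 𝕜 →L[𝕜] L2 𝕜, ∀ f : L2 𝕜, ∃ hu : T f ∈ formDomain 𝕜 V,
      ∀ v : formDomain 𝕜 V, form V ⟨T f, hu⟩ v = ⟪f, (v : L2 𝕜)⟫_𝕜 := by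
  obtain ⟨T, hT⟩ := exists_solution_of_isClosed_graph (isClosed_formGraph (𝕜 := 𝕜) (V := V)) hc
    fun z hz => by
      obtain ⟨hu, h1, h2⟩ := mem_formDomain_of_mem_formGraph hz
      have h3 := hco ⟨_, hu⟩
      rwa [energy, h1, h2, ← WithLp.prod_norm_sq_eq_of_L2] at h3
  refine ⟨T, fun f => ?_⟩
  obtain ⟨z, hz, hzT, h⟩ := hT f
  obtain ⟨hu, h1, h2⟩ := mem_formDomain_of_mem_formGraph hz
  rw [← hzT]
  refine ⟨hu, fun v => ?_⟩
  refine Eq.trans ?_ (h _ (toLp_mem_formGraph v))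
  rw [form_eq_inner, h1, h2]
  rfl

/-- A solution operator of the form inverts the operator generated by the form. -/
theorem isBoundedInverse_of_form_solution (hV : ∀ x, 0 ≤ V x) (hVi : LocallyIntegrable V volume)
    {c s : ℝ} (hs : 0 < s)
    (hco : ∀ u : formDomain 𝕜 V, ‖(u : L2 𝕜)‖ ^ 2 ≤ c * energy u) {T : L2 𝕜 →L[𝕜] L2 𝕜}
    (hT : ∀ f : L2 𝕜, ∃ hu : T f ∈ formDomain 𝕜 V,
      ∀ v : formDomain 𝕜 V, (s : 𝕜) * form V ⟨T f, hu⟩ v = ⟪f, (v : L2 𝕜)⟫_𝕜) :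
    IsBoundedInverse ((s : 𝕜) • schrodingerOp 𝕜 V) T := by
  have hs' : (s : 𝕜) ≠ 0 := by simpa using hs.ne'
  have hgr := schrodingerOp_graph (dense_formDomain (𝕜 := 𝕜) hV hVi)
  have hright : ∀ f : L2 𝕜, ∃ hf : T f ∈ ((s : 𝕜) • schrodingerOp 𝕜 V).domain,
      ((s : 𝕜) • schrodingerOp 𝕜 V) ⟨T f, hf⟩ = f := by
    intro f
    obtain ⟨hu, h⟩ := hT f
    have hmem : (T f, (s : 𝕜)⁻¹ • f) ∈ (schrodingerOp 𝕜 V).graph := by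
      rw [hgr]
      refine ⟨hu, fun v => ?_⟩
      rw [inner_smul_left, ← h v, map_inv₀, RCLike.conj_ofReal, inv_mul_cancel_left₀ hs']
    obtain ⟨y, hy1, hy2⟩ := (LinearPMap.mem_graph_iff _).1 hmem
    simp only at hy1 hy2
    have hd : T f ∈ (schrodingerOp 𝕜 V).domain := hy1 ▸ y.2
    refine ⟨hd, ?_⟩
    have hy : y = ⟨T f, hd⟩ := Subtype.ext hy1
    rw [LinearPMap.smul_apply]
    change (s : 𝕜) • schrodingerOp 𝕜 V ⟨T f, hd⟩ = f
    rw [← hy, hy2, smul_inv_smul₀ hs']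
  refine ⟨hright, fun u => ?_⟩
  -- the difference of two solutions has vanishing energy
  have hmem : ((u : L2 𝕜), schrodingerOp 𝕜 V ⟨u, u.2⟩) ∈ schrodingerGraph 𝕜 V := by
    rw [← hgr]
    exact LinearPMap.mem_graph (schrodingerOp 𝕜 V) ⟨(u : L2 𝕜), u.2⟩
  have hmem2 : (T (((s : 𝕜) • schrodingerOp 𝕜 V) u), schrodingerOp 𝕜 V ⟨u, u.2⟩) ∈
      schrodingerGraph 𝕜 V := by
    obtain ⟨hu, h⟩ := hT (((s : 𝕜) • schrodingerOp 𝕜 V) u)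
    refine ⟨hu, fun v => ?_⟩
    refine mul_left_cancel₀ hs' ((h v).trans ?_)
    rw [LinearPMap.smul_apply, inner_smul_left, RCLike.conj_ofReal]
    rfl
  obtain ⟨hd, h⟩ := (schrodingerGraph 𝕜 V).sub_mem hmem2 hmem
  have h0 := h ⟨_, hd⟩
  rw [form_self, Prod.snd_sub, sub_self, inner_zero_left, RCLike.ofReal_eq_zero] at h0
  have h1 := hco ⟨_, hd⟩
  rw [h0, mul_zero] at h1
  have h2 : ‖T (((s : 𝕜) • schrodingerOp 𝕜 V) u) - (u : L2 𝕜)‖ = 0 :=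
    pow_eq_zero_iff two_ne_zero |>.1 (le_antisymm h1 (by positivity))
  exact sub_eq_zero.1 (norm_eq_zero.1 h2)

end inverse

/-! ### Comparison of two Schrödinger operators -/

section comparison

variable {𝕜 : Type*} [RCLike 𝕜]

variable {V₁ V₂ : ℝ → ℝ}

/-- The bound for the potential terms after cutting off: only the `L¹` distance of the potentials
near the origin enters, because elements of the form domains are bounded. -/
lemma norm_inner_potPart_sub_le (hV₁ : ∀ x, 0 ≤ V₁ x) (hV₂ : ∀ x, 0 ≤ V₂ x) {s : Set ℝ}
    (hs : MeasurableSet s) (hi : IntegrableOn (fun x => |V₁ x - V₂ x|) s)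
    {χ : ℝ → ℝ} (h0 : MemLp χ ⊤ volume) (hχ1 : ∀ x, |χ x| ≤ 1) (hχs : ∀ x ∉ s, χ x = 0)
    (u : formDomain 𝕜 V₁) (v : formDomain 𝕜 V₂)
    (hu : bddMul h0 (u : L2 𝕜) ∈ formDomain 𝕜 V₂) (hv : bddMul h0 (v : L2 𝕜) ∈ formDomain 𝕜 V₁)
    {A B : ℝ} (hA : ∀ᵐ x, ‖(u : L2 𝕜) x‖ ≤ A) (hB : ∀ᵐ x, ‖(v : L2 𝕜) x‖ ≤ B) :
    ‖⟪potPart u, potPart ⟨_, hv⟩⟫_𝕜 - ⟪potPart ⟨_, hu⟩, potPart v⟫_𝕜‖ ≤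
      A * B * ∫ x in s, |V₁ x - V₂ x| := by
  rw [L2.inner_def, L2.inner_def,
    ← integral_sub (L2.integrable_inner _ _) (L2.integrable_inner _ _), ← integral_const_mul,
    ← integral_indicator hs]
  refine norm_integral_le_of_norm_le ((integrable_indicator_iff hs).2 (hi.const_mul (A * B))) ?_
  filter_upwards [coeFn_potPart u, coeFn_potPart v, coeFn_potPart ⟨_, hu⟩, coeFn_potPart ⟨_, hv⟩,
    coeFn_bddMul h0 (u : L2 𝕜), coeFn_bddMul h0 (v : L2 𝕜), hA, hB]
    with x e1 e2 e3 e4 e5 e6 hxA hxB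
  have hsq (V : ℝ → ℝ) (hV : ∀ x, 0 ≤ V x) :
      ((√(V x) : ℝ) : 𝕜) * ((√(V x) : ℝ) : 𝕜) = (V x : 𝕜) := by
    rw [← RCLike.ofReal_mul, Real.mul_self_sqrt (hV x)]
  have hxe : ⟪potPart u x, potPart ⟨_, hv⟩ x⟫_𝕜 - ⟪potPart ⟨_, hu⟩ x, potPart v x⟫_𝕜 =
      ((χ x * (V₁ x - V₂ x) : ℝ) : 𝕜) * (conj ((u : L2 𝕜) x) * (v : L2 𝕜) x) := by
    rw [e1, e2, e3, e4, RCLike.ofReal_mul, RCLike.ofReal_sub, ← hsq V₁ hV₁, ← hsq V₂ hV₂]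
    simp only [e5, e6, RCLike.inner_apply, map_mul, RCLike.conj_ofReal,
      RCLike.real_smul_eq_coe_mul]
    ring
  rw [hxe]
  by_cases hx : x ∈ s
  · rw [Set.indicator_of_mem hx, norm_mul, norm_mul, RCLike.norm_ofReal, RCLike.norm_conj, abs_mul]
    have h1 : ‖(u : L2 𝕜) x‖ * ‖(v : L2 𝕜) x‖ ≤ A * B :=
      mul_le_mul hxA hxB (norm_nonneg _) ((norm_nonneg _).trans hxA)
    calc |χ x| * |V₁ x - V₂ x| * (‖(u : L2 𝕜) x‖ * ‖(v : L2 𝕜) x‖)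
        ≤ 1 * |V₁ x - V₂ x| * (A * B) := by
          gcongr
          exact hχ1 x
      _ = A * B * |V₁ x - V₂ x| := by ring
  · simp [hχs x hx, Set.indicator_of_notMem hx]

/-- A function in the form domain is small outside the region where the potential is small. -/
lemma norm_sub_bddMul_le {V : ℝ → ℝ} {a κ : ℝ} (hκ : 0 < κ)
    (hVκ : ∀ x, a ≤ |x| → κ ≤ V x) {χ : ℝ → ℝ} (h0 : MemLp χ ⊤ volume)
    (hχ0 : ∀ x, 0 ≤ χ x) (hχ1 : ∀ x, χ x ≤ 1) (hχa : ∀ x, |x| ≤ a → χ x = 1)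
    (u : formDomain 𝕜 V) :
    ‖(u : L2 𝕜) - bddMul h0 (u : L2 𝕜)‖ ≤ (√κ)⁻¹ * ‖potPart u‖ := by
  refine Lp.norm_le_mul_norm_of_ae_le_mul ?_
  filter_upwards [coeFn_bddMul h0 (u : L2 𝕜), coeFn_potPart u,
    Lp.coeFn_sub (u : L2 𝕜) (bddMul h0 (u : L2 𝕜))] with x h1 h2 h3
  have h4 : (u : L2 𝕜) x - χ x • (u : L2 𝕜) x = (1 - χ x) • (u : L2 𝕜) x := by
    rw [sub_smul, one_smul]
  rw [h3, Pi.sub_apply, h1, h2, h4, norm_smul, norm_mul, RCLike.norm_ofReal,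
    abs_of_nonneg (Real.sqrt_nonneg _), Real.norm_of_nonneg (by linarith [hχ1 x]), ← mul_assoc]
  refine mul_le_mul_of_nonneg_right ?_ (norm_nonneg _)
  rcases le_total |x| a with h | h
  · rw [hχa x h, sub_self]
    positivity
  · have h5 : √κ ≤ √(V x) := Real.sqrt_le_sqrt (hVκ x h)
    have h6 : 0 < √κ := Real.sqrt_pos.2 hκ
    rw [← div_eq_inv_mul]
    exact (by linarith [hχ0 x] : 1 - χ x ≤ 1).trans ((one_le_div h6).2 h5)

/-- `T` is the solution operator of the form `δ² ∫ (u' v' + V u v)`. -/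
def IsScaledSolution (V : ℝ → ℝ) (δ : ℝ) (T : L2 𝕜 →L[𝕜] L2 𝕜) : Prop :=
  ∀ f : L2 𝕜, ∃ hu : T f ∈ formDomain 𝕜 V, ∀ v : formDomain 𝕜 V,
    ((δ ^ 2 : ℝ) : 𝕜) * form V ⟨T f, hu⟩ v = ⟪f, (v : L2 𝕜)⟫_𝕜

variable {V : ℝ → ℝ} {δ c : ℝ} {T : L2 𝕜 →L[𝕜] L2 𝕜}

lemma IsScaledSolution.inner_symm (hT : IsScaledSolution V δ T) (f g : L2 𝕜) :
    ⟪T f, g⟫_𝕜 = ⟪f, T g⟫_𝕜 := by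
  obtain ⟨hu, h1⟩ := hT f
  obtain ⟨hv, h2⟩ := hT g
  rw [← h1 ⟨_, hv⟩, ← inner_conj_symm, ← h2 ⟨_, hu⟩, map_mul, RCLike.conj_ofReal, conj_form]

/-- Energy estimates for solutions: `‖u‖`, `δ ‖u'‖` and `δ ‖√V u‖` are bounded by the data. -/
lemma IsScaledSolution.bounds (hT : IsScaledSolution V δ T) (hδ : 0 < δ) (hc : 0 < c)
    (hco : ∀ u : formDomain 𝕜 V, ‖(u : L2 𝕜)‖ ^ 2 ≤ c * (δ ^ 2 * energy u)) (f : L2 𝕜)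
    (hu : T f ∈ formDomain 𝕜 V) :
    ‖T f‖ ≤ c * ‖f‖ ∧ δ * ‖gradPart ⟨T f, hu⟩‖ ≤ √c * ‖f‖ ∧
      δ * ‖potPart ⟨T f, hu⟩‖ ≤ √c * ‖f‖ := by
  obtain ⟨hu', h⟩ := hT f
  have h1 := h ⟨T f, hu⟩
  rw [form_self, ← RCLike.ofReal_mul] at h1
  have h2 : δ ^ 2 * energy ⟨T f, hu⟩ ≤ ‖f‖ * ‖T f‖ := by
    have := norm_inner_le_norm (𝕜 := 𝕜) f (T f)
    rw [← h1, RCLike.norm_ofReal] at this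
    exact (le_abs_self _).trans this
  have h3 := hco ⟨T f, hu⟩
  have h4 : ‖T f‖ ≤ c * ‖f‖ := by
    by_contra hlt
    push Not at hlt
    have h5 : 0 < ‖T f‖ := lt_of_le_of_lt (by positivity) hlt
    have h6 : ‖T f‖ ^ 2 ≤ c * (‖f‖ * ‖T f‖) := h3.trans (mul_le_mul_of_nonneg_left h2 hc.le)
    nlinarith
  have h5 : δ ^ 2 * energy ⟨T f, hu⟩ ≤ c * ‖f‖ ^ 2 := by
    refine h2.trans ?_
    calc ‖f‖ * ‖T f‖ ≤ ‖f‖ * (c * ‖f‖) := by gcongr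
      _ = c * ‖f‖ ^ 2 := by ring
  have h6 : √c * ‖f‖ = √(c * ‖f‖ ^ 2) := by
    rw [Real.sqrt_mul hc.le, Real.sqrt_sq (norm_nonneg _)]
  rw [energy] at h5
  refine ⟨h4, ?_, ?_⟩
  · rw [h6]
    refine Real.le_sqrt_of_sq_le (le_trans ?_ h5)
    rw [mul_pow]
    gcongr
    exact le_add_of_nonneg_right (by positivity)
  · rw [h6]
    refine Real.le_sqrt_of_sq_le (le_trans ?_ h5)
    rw [mul_pow]
    gcongr
    exact le_add_of_nonneg_left (by positivity)

/-- At the length scale `δ`, the Sobolev inequality bounds solutions in the supremum norm. -/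
lemma IsScaledSolution.ae_norm_le (hT : IsScaledSolution V δ T) (hδ : 0 < δ) (hc : 0 < c)
    (hco : ∀ u : formDomain 𝕜 V, ‖(u : L2 𝕜)‖ ^ 2 ≤ c * (δ ^ 2 * energy u)) (f : L2 𝕜) :
    ∀ᵐ x, ‖T f x‖ ≤ √(2 / δ * (c ^ 2 + c)) * ‖f‖ := by
  obtain ⟨hu, -⟩ := hT f
  obtain ⟨h1, h2, -⟩ := hT.bounds hδ hc hco f hu
  filter_upwards [(hasWeakDeriv_gradPart ⟨T f, hu⟩).norm_sq_le_sobolev hδ] with x hx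
  have h3 : ‖T f‖ ^ 2 ≤ (c * ‖f‖) ^ 2 := pow_le_pow_left₀ (norm_nonneg _) h1 2
  have h4 : (δ * ‖gradPart ⟨T f, hu⟩‖) ^ 2 ≤ (√c * ‖f‖) ^ 2 :=
    pow_le_pow_left₀ (by positivity) h2 2
  rw [mul_pow √c, Real.sq_sqrt hc.le] at h4
  have h5 : √(2 / δ * (c ^ 2 + c)) * ‖f‖ = √(2 / δ * (c ^ 2 + c) * ‖f‖ ^ 2) := by
    rw [Real.sqrt_mul (by positivity) (‖f‖ ^ 2), Real.sqrt_sq (norm_nonneg _)]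
  rw [h5]
  refine Real.le_sqrt_of_sq_le (hx.trans ?_)
  calc 2 / δ * ‖T f‖ ^ 2 + 2 * δ * ‖gradPart ⟨T f, hu⟩‖ ^ 2
      = 2 / δ * (‖T f‖ ^ 2 + (δ * ‖gradPart ⟨T f, hu⟩‖) ^ 2) := by field_simp
    _ ≤ 2 / δ * ((c * ‖f‖) ^ 2 + c * ‖f‖ ^ 2) := by gcongr
    _ = 2 / δ * (c ^ 2 + c) * ‖f‖ ^ 2 := by ring

/-- A smooth cutoff function: `1` on `[-1, 1]`, vanishing outside `[-2, 2]`. -/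
lemma exists_cutoff : ∃ (B : ℝ) (χ : ℝ → ℝ), 0 < B ∧ ContDiff ℝ ∞ χ ∧ (∀ x, 0 ≤ χ x) ∧
    (∀ x, χ x ≤ 1) ∧ (∀ x, |x| ≤ 1 → χ x = 1) ∧ (∀ x, 2 ≤ |x| → χ x = 0) ∧
    ∀ x, |deriv χ x| ≤ B := by
  let f : ContDiffBump (0 : ℝ) := ⟨1, 2, one_pos, one_lt_two⟩
  have hd : Continuous (deriv f) := (f.contDiff (n := 1)).continuous_deriv le_rfl
  obtain ⟨B, hB⟩ := hd.bounded_above_of_compact_support f.hasCompactSupport.deriv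
  refine ⟨|B| + 1, f, by positivity, f.contDiff, fun x => f.nonneg, fun x => f.le_one,
    fun x hx => f.one_of_mem_closedBall (by simpa using hx),
    fun x hx => f.zero_of_le_dist (by simpa using hx), fun x => ?_⟩
  exact (hB x).trans ((le_abs_self B).trans (by linarith))

/-- The quantitative comparison of two solution operators. The cutoff `χ` lives on the scale `a`;
outside `[-a, a]` both potentials exceed `κ`. -/
theorem norm_inner_sub_le {T₁ T₂ : L2 𝕜 →L[𝕜] L2 𝕜}
    (hV₁ : ∀ x, 0 ≤ V₁ x) (hV₂ : ∀ x, 0 ≤ V₂ x) (hi₁ : LocallyIntegrable V₁ volume)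
    (hi₂ : LocallyIntegrable V₂ volume) (hδ : 0 < δ) (hc : 0 < c)
    (hco₁ : ∀ u : formDomain 𝕜 V₁, ‖(u : L2 𝕜)‖ ^ 2 ≤ c * (δ ^ 2 * energy u))
    (hco₂ : ∀ u : formDomain 𝕜 V₂, ‖(u : L2 𝕜)‖ ^ 2 ≤ c * (δ ^ 2 * energy u))
    (hT₁ : IsScaledSolution V₁ δ T₁) (hT₂ : IsScaledSolution V₂ δ T₂)
    {a κ : ℝ} (hκ : 0 < κ) (hκ₁ : ∀ x, a ≤ |x| → κ ≤ V₁ x) (hκ₂ : ∀ x, a ≤ |x| → κ ≤ V₂ x)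
    {χ : ℝ → ℝ} (hχ : ContDiff ℝ ∞ χ) (hχ0 : ∀ x, 0 ≤ χ x) (hχ1 : ∀ x, χ x ≤ 1)
    (hχa : ∀ x, |x| ≤ a → χ x = 1) (hχs : ∀ x ∉ Set.Icc (-(2 * a)) (2 * a), χ x = 0)
    {b : ℝ} (hb : ∀ x, |deriv χ x| ≤ b) (f g : L2 𝕜) :
    ‖⟪f, T₂ g⟫_𝕜 - ⟪T₁ f, g⟫_𝕜‖ ≤ (2 * (√c / (δ * √κ)) + 2 * δ * b * c * √c +
      2 * δ * (c ^ 2 + c) * ∫ x in Set.Icc (-(2 * a)) (2 * a), |V₁ x - V₂ x|) *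
        (‖f‖ * ‖g‖) := by
  have hχc : HasCompactSupport χ := HasCompactSupport.intro isCompact_Icc hχs
  have h0 : MemLp χ ⊤ volume := memLp_top_of_hasCompactSupport hχ.continuous hχc
  have h1 : MemLp (deriv χ) ⊤ volume :=
    memLp_top_of_hasCompactSupport (hχ.continuous_deriv (by norm_num)) hχc.deriv
  obtain ⟨hu, hfu⟩ := hT₁ f
  obtain ⟨hv, hgv⟩ := hT₂ g
  obtain ⟨bu1, bu2, bu3⟩ := hT₁.bounds hδ hc hco₁ f hu
  obtain ⟨bv1, bv2, bv3⟩ := hT₂.bounds hδ hc hco₂ g hv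
  set u : formDomain 𝕜 V₁ := ⟨T₁ f, hu⟩ with hudef
  set v : formDomain 𝕜 V₂ := ⟨T₂ g, hv⟩ with hvdef
  have hdu := hasWeakDeriv_gradPart u
  have hdv := hasWeakDeriv_gradPart v
  have hχu : bddMul h0 (u : L2 𝕜) ∈ formDomain 𝕜 V₂ :=
    bddMul_mem_formDomain hV₂ hi₂ hdu hχ hχc h0
  have hχv : bddMul h0 (v : L2 𝕜) ∈ formDomain 𝕜 V₁ :=
    bddMul_mem_formDomain hV₁ hi₁ hdv hχ hχc h0
  have e1 := hfu ⟨_, hχv⟩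
  have e2 : ((δ ^ 2 : ℝ) : 𝕜) * form V₂ ⟨_, hχu⟩ v = ⟪bddMul h0 (u : L2 𝕜), g⟫_𝕜 := by
    rw [← inner_conj_symm, ← hgv ⟨_, hχu⟩, map_mul, RCLike.conj_ofReal, conj_form]
  -- the terms with `χ u' v'` cancel
  have e3 : form V₁ u ⟨_, hχv⟩ - form V₂ ⟨_, hχu⟩ v =
      (⟪gradPart u, bddMul h1 (v : L2 𝕜)⟫_𝕜 - ⟪bddMul h1 (u : L2 𝕜), gradPart v⟫_𝕜) +
      (⟪potPart u, potPart ⟨_, hχv⟩⟫_𝕜 - ⟪potPart ⟨_, hχu⟩, potPart v⟫_𝕜) := by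
    rw [form_eq_inner, form_eq_inner, gradPart_eq (u := ⟨_, hχv⟩) (hdv.bddMul hχ h0 h1),
      gradPart_eq (u := ⟨_, hχu⟩) (hdu.bddMul hχ h0 h1), inner_add_left, inner_add_right,
      inner_bddMul_left h0 (gradPart u)]
    ring
  have hdecomp : ⟪f, (v : L2 𝕜)⟫_𝕜 - ⟪(u : L2 𝕜), g⟫_𝕜 =
      ⟪f, (v : L2 𝕜) - bddMul h0 (v : L2 𝕜)⟫_𝕜 - ⟪(u : L2 𝕜) - bddMul h0 (u : L2 𝕜), g⟫_𝕜 +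
      ((δ ^ 2 : ℝ) : 𝕜) *
        (⟪gradPart u, bddMul h1 (v : L2 𝕜)⟫_𝕜 - ⟪bddMul h1 (u : L2 𝕜), gradPart v⟫_𝕜) +
      ((δ ^ 2 : ℝ) : 𝕜) *
        (⟪potPart u, potPart ⟨_, hχv⟩⟫_𝕜 - ⟪potPart ⟨_, hχu⟩, potPart v⟫_𝕜) := by
    rw [add_assoc, ← mul_add, ← e3, mul_sub, e1, e2, inner_sub_left, inner_sub_right]
    ring
  have hsκ : 0 < √κ := Real.sqrt_pos.2 hκ
  have t1 : ‖⟪f, (v : L2 𝕜) - bddMul h0 (v : L2 𝕜)⟫_𝕜‖ ≤ √c / (δ * √κ) * (‖f‖ * ‖g‖) := by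
    refine (norm_inner_le_norm _ _).trans ?_
    have := norm_sub_bddMul_le hκ hκ₂ h0 hχ0 hχ1 hχa v
    have h' : ‖potPart v‖ ≤ √c * ‖g‖ / δ := (le_div_iff₀' hδ).2 bv3
    calc ‖f‖ * ‖(v : L2 𝕜) - bddMul h0 (v : L2 𝕜)‖
        ≤ ‖f‖ * ((√κ)⁻¹ * (√c * ‖g‖ / δ)) := by
          gcongr
          exact this.trans (by gcongr)
      _ = √c / (δ * √κ) * (‖f‖ * ‖g‖) := by field_simp
  have t2 : ‖⟪(u : L2 𝕜) - bddMul h0 (u : L2 𝕜), g⟫_𝕜‖ ≤ √c / (δ * √κ) * (‖f‖ * ‖g‖) := by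
    refine (norm_inner_le_norm _ _).trans ?_
    have := norm_sub_bddMul_le hκ hκ₁ h0 hχ0 hχ1 hχa u
    have h' : ‖potPart u‖ ≤ √c * ‖f‖ / δ := (le_div_iff₀' hδ).2 bu3
    calc ‖(u : L2 𝕜) - bddMul h0 (u : L2 𝕜)‖ * ‖g‖
        ≤ ((√κ)⁻¹ * (√c * ‖f‖ / δ)) * ‖g‖ := by
          gcongr
          exact this.trans (by gcongr)
      _ = √c / (δ * √κ) * (‖f‖ * ‖g‖) := by field_simp
  have hb0 : 0 ≤ b := (abs_nonneg _).trans (hb 0)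
  have hnd : ‖((δ ^ 2 : ℝ) : 𝕜)‖ = δ * δ := by
    rw [RCLike.norm_ofReal, abs_of_nonneg (by positivity), sq]
  have t3 : ‖((δ ^ 2 : ℝ) : 𝕜) *
      (⟪gradPart u, bddMul h1 (v : L2 𝕜)⟫_𝕜 - ⟪bddMul h1 (u : L2 𝕜), gradPart v⟫_𝕜)‖ ≤
      2 * δ * b * c * √c * (‖f‖ * ‖g‖) := by
    rw [norm_mul, hnd]
    have s1 : ‖⟪gradPart u, bddMul h1 (v : L2 𝕜)⟫_𝕜‖ ≤ ‖gradPart u‖ * (b * (c * ‖g‖)) := by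
      refine (norm_inner_le_norm _ _).trans ?_
      gcongr
      exact (norm_bddMul_le h1 hb _).trans (by gcongr)
    have s2 : ‖⟪bddMul h1 (u : L2 𝕜), gradPart v⟫_𝕜‖ ≤ (b * (c * ‖f‖)) * ‖gradPart v‖ := by
      refine (norm_inner_le_norm _ _).trans ?_
      gcongr
      exact (norm_bddMul_le h1 hb _).trans (by gcongr)
    calc δ * δ * ‖⟪gradPart u, bddMul h1 (v : L2 𝕜)⟫_𝕜 - ⟪bddMul h1 (u : L2 𝕜), gradPart v⟫_𝕜‖
        ≤ δ * δ * (‖gradPart u‖ * (b * (c * ‖g‖)) + (b * (c * ‖f‖)) * ‖gradPart v‖) := by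
          gcongr
          exact (norm_sub_le _ _).trans (add_le_add s1 s2)
      _ = δ * b * c * ((δ * ‖gradPart u‖) * ‖g‖ + ‖f‖ * (δ * ‖gradPart v‖)) := by ring
      _ ≤ δ * b * c * ((√c * ‖f‖) * ‖g‖ + ‖f‖ * (√c * ‖g‖)) := by gcongr
      _ = 2 * δ * b * c * √c * (‖f‖ * ‖g‖) := by ring
  set D := ∫ x in Set.Icc (-(2 * a)) (2 * a), |V₁ x - V₂ x| with hD
  have t4 : ‖((δ ^ 2 : ℝ) : 𝕜) *
      (⟪potPart u, potPart ⟨_, hχv⟩⟫_𝕜 - ⟪potPart ⟨_, hχu⟩, potPart v⟫_𝕜)‖ ≤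
      2 * δ * (c ^ 2 + c) * D * (‖f‖ * ‖g‖) := by
    rw [norm_mul, hnd]
    have := norm_inner_potPart_sub_le hV₁ hV₂ (measurableSet_Icc (a := -(2 * a)) (b := 2 * a))
      ((hi₁.sub hi₂).integrableOn_isCompact isCompact_Icc).norm h0
      (fun x => by rw [abs_of_nonneg (hχ0 x)]; exact hχ1 x) hχs u v hχu hχv
      (hT₁.ae_norm_le hδ hc hco₁ f) (hT₂.ae_norm_le hδ hc hco₂ g)
    refine (mul_le_mul_of_nonneg_left this (by positivity)).trans (le_of_eq ?_)
    have hr : √(2 / δ * (c ^ 2 + c)) * √(2 / δ * (c ^ 2 + c)) = 2 / δ * (c ^ 2 + c) :=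
      Real.mul_self_sqrt (by positivity)
    calc δ * δ * (√(2 / δ * (c ^ 2 + c)) * ‖f‖ * (√(2 / δ * (c ^ 2 + c)) * ‖g‖) * D)
        = δ * δ * (√(2 / δ * (c ^ 2 + c)) * √(2 / δ * (c ^ 2 + c))) * D * (‖f‖ * ‖g‖) := by ring
      _ = 2 * δ * (c ^ 2 + c) * D * (‖f‖ * ‖g‖) := by
        rw [hr]
        field_simp
  change ‖⟪f, (v : L2 𝕜)⟫_𝕜 - ⟪(u : L2 𝕜), g⟫_𝕜‖ ≤ _
  rw [hdecomp]
  refine (norm_add_le _ _).trans ?_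
  refine (add_le_add ((norm_add_le _ _).trans (add_le_add ((norm_sub_le _ _).trans
    (add_le_add t1 t2)) t3)) t4).trans (le_of_eq ?_)
  ring

/-- The comparison in operator norm, with lengths measured in units of `δ`. -/
theorem exists_norm_sub_le : ∃ B : ℝ, 0 < B ∧ ∀ {V₁ V₂ : ℝ → ℝ} {T₁ T₂ : L2 𝕜 →L[𝕜] L2 𝕜}
    {δ c Y K : ℝ}, (∀ x, 0 ≤ V₁ x) → (∀ x, 0 ≤ V₂ x) → LocallyIntegrable V₁ volume →
    LocallyIntegrable V₂ volume → 0 < δ → 0 < c → 0 < Y → 0 < K →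
    (∀ u : formDomain 𝕜 V₁, ‖(u : L2 𝕜)‖ ^ 2 ≤ c * (δ ^ 2 * energy u)) →
    (∀ u : formDomain 𝕜 V₂, ‖(u : L2 𝕜)‖ ^ 2 ≤ c * (δ ^ 2 * energy u)) →
    IsScaledSolution V₁ δ T₁ → IsScaledSolution V₂ δ T₂ →
    (∀ x, Y * δ ≤ |x| → K / δ ^ 2 ≤ V₁ x) → (∀ x, Y * δ ≤ |x| → K / δ ^ 2 ≤ V₂ x) →
    ‖T₁ - T₂‖ ≤ 2 * √c / √K + B * c * √c / Y + 2 * (c ^ 2 + c) *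
      (δ * ∫ x in Set.Icc (-(2 * (Y * δ))) (2 * (Y * δ)), |V₁ x - V₂ x|) := by
  obtain ⟨B, χ, hB, hχ, hχ0, hχ1, hχa, hχs, hχd⟩ := exists_cutoff
  refine ⟨2 * B, by positivity, ?_⟩
  intro V₁ V₂ T₁ T₂ δ c Y K hV₁ hV₂ hi₁ hi₂ hδ hc hY hK hco₁ hco₂ hT₁ hT₂ hκ₁ hκ₂
  have ha : 0 < Y * δ := by positivity
  have hder : ∀ x, deriv (fun x => χ (x / (Y * δ))) x = deriv χ (x / (Y * δ)) / (Y * δ) := by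
    intro x
    have h1 : HasDerivAt (fun x => x / (Y * δ)) (1 / (Y * δ)) x := (hasDerivAt_id x).div_const _
    have h2 := ((hχ.differentiable (by norm_num) (x / (Y * δ))).hasDerivAt.comp x h1).deriv
    rw [mul_one_div] at h2
    exact h2
  have key := norm_inner_sub_le hV₁ hV₂ hi₁ hi₂ hδ hc hco₁ hco₂ hT₁ hT₂
    (a := Y * δ) (κ := K / δ ^ 2) (by positivity) hκ₁ hκ₂ (χ := fun x => χ (x / (Y * δ)))
    (hχ.comp (contDiff_id.div_const _)) (fun x => hχ0 _) (fun x => hχ1 _)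
    (fun x hx => hχa _ (by rwa [abs_div, abs_of_pos ha, div_le_one ha]))
    (fun x hx => hχs _ (by
      rw [abs_div, abs_of_pos ha, le_div_iff₀ ha]
      by_contra h
      exact hx (abs_le.1 (not_le.1 h).le)))
    (b := B / (Y * δ)) (fun x => by
      rw [hder, abs_div, abs_of_pos ha]
      gcongr
      exact hχd _)
  have hsK : √(K / δ ^ 2) = √K / δ := by rw [Real.sqrt_div' _ (by positivity), Real.sqrt_sq hδ.le]
  set D := ∫ x in Set.Icc (-(2 * (Y * δ))) (2 * (Y * δ)), |V₁ x - V₂ x|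
  have hD : 0 ≤ D := integral_nonneg fun x => abs_nonneg _
  set N := 2 * √c / √K + 2 * B * c * √c / Y + 2 * (c ^ 2 + c) * (δ * D)
  have hN : 2 * (√c / (δ * √(K / δ ^ 2))) + 2 * δ * (B / (Y * δ)) * c * √c +
      2 * δ * (c ^ 2 + c) * D = N := by
    have : 0 < √K := Real.sqrt_pos.2 hK
    rw [hsK]
    simp only [N]
    field_simp
  rw [hN] at key
  refine ContinuousLinearMap.opNorm_le_bound _ (by positivity) fun f => ?_
  have h1 := key f (T₁ f - T₂ f)
  rw [← hT₂.inner_symm, ← inner_sub_left, ← neg_sub, inner_neg_left, norm_neg,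
    inner_self_eq_norm_sq_to_K, norm_pow, RCLike.norm_ofReal, sq_abs] at h1
  rw [sub_apply]
  rcases eq_or_lt_of_le (norm_nonneg (T₁ f - T₂ f)) with h2 | h2
  · rw [← h2]
    positivity
  · nlinarith

end comparison

/-! ### The potentials -/

section profile

variable {h : ℝ → ℝ} {M cp cm m : ℝ}

/-- The well `π² (h⁻² - M⁻²)`, the part of `W h M ε` with the factor `ε⁻²`. -/
noncomputable def well (h : ℝ → ℝ) (M x : ℝ) : ℝ := Real.pi ^ 2 * (1 / h x ^ 2 - 1 / M ^ 2)

/-- The part of `W h M ε` that does not depend on `ε`. -/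
noncomputable def derivPot (h : ℝ → ℝ) (x : ℝ) : ℝ :=
  (Real.pi ^ 2 / 3 + 1 / 4) * (deriv h x ^ 2 / h x ^ 2)

lemma W_eq (h : ℝ → ℝ) (M ε x : ℝ) : W h M ε x = well h M x / ε ^ 2 + derivPot h x := by
  rw [W, well, derivPot]
  ring

lemma derivPot_nonneg (h : ℝ → ℝ) (x : ℝ) : 0 ≤ derivPot h x := by
  rw [derivPot]
  positivity

lemma isLittleO_abs_rpow_add_one (m : ℝ) :
    (fun x : ℝ => |x| ^ (m + 1)) =o[𝓝[≠] 0] fun x => |x| ^ m := by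
  rw [isLittleO_iff_tendsto']
  · have h1 : Tendsto (fun x : ℝ => |x|) (𝓝[≠] 0) (𝓝 0) :=
      (continuous_abs.tendsto' 0 0 abs_zero).mono_left nhdsWithin_le_nhds
    refine h1.congr' ?_
    filter_upwards [self_mem_nhdsWithin] with x hx
    have h2 : 0 < |x| := abs_pos.2 hx
    rw [Real.rpow_add h2, Real.rpow_one, mul_div_cancel_left₀ _ (Real.rpow_pos_of_pos h2 m).ne']
  · filter_upwards [self_mem_nhdsWithin] with x hx h0
    exact absurd h0 (Real.rpow_pos_of_pos (abs_pos.2 hx) m).ne'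

lemma measurable_q (M cp cm m : ℝ) : Measurable (q M cp cm m) := by
  unfold q
  exact (measurable_const.mul (Measurable.ite measurableSet_Ioi measurable_const
    measurable_const)).mul (measurable_id.abs.pow_const m)

namespace IsProfile

variable (hh : IsProfile h M cp cm m)
include hh

lemma m_pos : 0 < m := lt_of_lt_of_le one_pos hh.one_le_m

lemma expansion_right_abs :
    (fun x => h x - (M - cp * |x| ^ m)) =O[𝓝[>] (0 : ℝ)] fun x => |x| ^ (m + 1) := by
  refine hh.expansion_right.congr' ?_ ?_ <;> filter_upwards [self_mem_nhdsWithin] with x hx <;>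
    rw [abs_of_pos hx]

lemma apply_zero : h 0 = M := by
  have hl : 𝓝[>] (0 : ℝ) ≤ 𝓝[≠] 0 := nhdsWithin_mono 0 fun x hx => ne_of_gt hx
  have hp (p : ℝ) (hp : 0 < p) : Tendsto (fun x : ℝ => |x| ^ p) (𝓝[>] 0) (𝓝 0) := by
    have h1 : Continuous fun x : ℝ => |x| ^ p := continuous_abs.rpow_const fun x => Or.inr hp.le
    exact (h1.tendsto' 0 0 (by rw [abs_zero, Real.zero_rpow hp.ne'])).mono_left nhdsWithin_le_nhds
  have h1 := hh.expansion_right_abs.trans_tendsto (hp (m + 1) (by linarith [hh.m_pos]))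
  have h2 : Tendsto (fun x => M - cp * |x| ^ m) (𝓝[>] 0) (𝓝 (M - cp * 0)) :=
    tendsto_const_nhds.sub ((hp m hh.m_pos).const_mul cp)
  have h3 := h1.add h2
  simp only [sub_add_cancel, zero_add, mul_zero, sub_zero] at h3
  exact tendsto_nhds_unique ((hh.continuous.tendsto 0).mono_left nhdsWithin_le_nhds) h3

lemma lt_M {x : ℝ} (hx : x ≠ 0) : h x < M := hh.apply_zero ▸ hh.lt_of_ne x hx

lemma le_M (x : ℝ) : h x ≤ M := by
  by_cases hx : x = 0
  · rw [hx, hh.apply_zero]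
  · exact (hh.lt_M hx).le

lemma continuous_well : Continuous (well h M) := by
  have h1 := hh.continuous
  have h2 : ∀ x, h x ^ 2 ≠ 0 := fun x => (pow_pos (hh.pos x) 2).ne'
  unfold well
  fun_prop (disch := assumption)

lemma well_mono {x b : ℝ} (hb : h x ≤ b) :
    Real.pi ^ 2 * (1 / b ^ 2 - 1 / M ^ 2) ≤ well h M x := by
  have h1 := hh.pos x
  rw [well]
  gcongr

lemma well_nonneg (x : ℝ) : 0 ≤ well h M x := by
  simpa using hh.well_mono (hh.le_M x)

lemma well_pos {x : ℝ} (hx : x ≠ 0) : 0 < well h M x := by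
  have h1 := hh.pos x
  have h2 := hh.lt_M hx
  have h3 : 1 / M ^ 2 < 1 / h x ^ 2 := by gcongr
  have := Real.pi_pos
  rw [well]
  exact mul_pos (by positivity) (by linarith)

lemma W_nonneg (ε x : ℝ) : 0 ≤ W h M ε x := by
  rw [W_eq]
  have := hh.well_nonneg x
  have := derivPot_nonneg h x
  positivity

lemma locallyIntegrable_derivPot : LocallyIntegrable (derivPot h) volume := by
  have h1 : Continuous fun x => (Real.pi ^ 2 / 3 + 1 / 4) / h x ^ 2 :=
    continuous_const.div (hh.continuous.pow 2) fun x => (pow_pos (hh.pos x) 2).ne'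
  have h2 := (hh.deriv_sq.locallyIntegrableOn Set.univ).continuousOn_mul h1.continuousOn
    isOpen_univ.isLocallyClosed
  rw [locallyIntegrableOn_univ] at h2
  refine h2.congr (Eventually.of_forall fun x => ?_)
  simp only [derivPot]
  ring

lemma locallyIntegrable_W (ε : ℝ) : LocallyIntegrable (W h M ε) volume := by
  have h1 : W h M ε = (fun x => well h M x / ε ^ 2) + derivPot h := funext fun x => W_eq h M ε x
  rw [h1]
  exact (hh.continuous_well.div_const _).locallyIntegrable.add hh.locallyIntegrable_derivPot

lemma q_nonneg (x : ℝ) : 0 ≤ q M cp cm m x := by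
  have := hh.M_pos
  have := hh.cp_pos
  have := hh.cm_pos
  rw [q]
  split_ifs <;> positivity

lemma locallyIntegrable_q_div (ε : ℝ) :
    LocallyIntegrable (fun x => q M cp cm m x / ε ^ 2) volume := by
  have h1 : Continuous fun x : ℝ => 2 * Real.pi ^ 2 / M ^ 3 * (cp + cm) * |x| ^ m / ε ^ 2 :=
    (continuous_const.mul
      (continuous_abs.rpow_const fun x => Or.inr hh.m_pos.le)).div_const _
  refine h1.locallyIntegrable.mono ((measurable_q M cp cm m).div_const _).aestronglyMeasurable
    (Eventually.of_forall fun x => ?_)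
  have h2 := hh.q_nonneg x
  rw [Real.norm_of_nonneg (by positivity)]
  refine le_trans ?_ (Real.le_norm_self _)
  have := hh.M_pos
  have := hh.cp_pos
  have := hh.cm_pos
  rw [q]
  gcongr
  split_ifs <;> linarith

/-- One-sided asymptotics of the well: `h⁻² - M⁻² = (M - h) (M + h) / (h M)²`. -/
lemma tendsto_well_sub_div {l : Filter ℝ} (hl : l ≤ 𝓝[≠] 0) {γ : ℝ}
    (he : (fun x => h x - (M - γ * |x| ^ m)) =O[l] fun x => |x| ^ (m + 1)) :
    Tendsto (fun x => (well h M x - 2 * Real.pi ^ 2 / M ^ 3 * γ * |x| ^ m) / |x| ^ m) l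
      (𝓝 0) := by
  have hM := hh.M_pos
  set φ : ℝ → ℝ := fun x => (M + h x) / (h x ^ 2 * M ^ 2) with hφ
  have h1 : Tendsto (fun x => (h x - (M - γ * |x| ^ m)) / |x| ^ m) l (𝓝 0) :=
    (he.trans_isLittleO ((isLittleO_abs_rpow_add_one m).mono hl)).tendsto_div_nhds_zero
  have h2 : Tendsto φ l (𝓝 (2 / M ^ 3)) := by
    have hc : Continuous φ := (continuous_const.add hh.continuous).div
      ((hh.continuous.pow 2).mul continuous_const) fun x =>
        (mul_pos (pow_pos (hh.pos x) 2) (pow_pos hM 2)).ne'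
    refine (hc.tendsto' 0 _ ?_).mono_left (hl.trans nhdsWithin_le_nhds)
    rw [hφ]
    simp only [hh.apply_zero]
    field_simp
    ring
  have h3 := ((h1.neg.mul h2).add ((h2.sub_const (2 / M ^ 3)).const_mul γ)).const_mul
    (Real.pi ^ 2)
  simp only [neg_zero, zero_mul, sub_self, mul_zero, add_zero] at h3
  refine h3.congr' ?_
  filter_upwards [hl self_mem_nhdsWithin] with x hx
  have hxp : |x| ^ m ≠ 0 := (Real.rpow_pos_of_pos (abs_pos.2 hx) m).ne'
  have hhx : h x ≠ 0 := (hh.pos x).ne'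
  simp only [hφ, well]
  field_simp
  ring

/-- The well agrees with `q` to leading order at the origin. -/
lemma exists_abs_well_sub_q_le {η : ℝ} (hη : 0 < η) :
    ∃ r > 0, ∀ x, |x| < r → |well h M x - q M cp cm m x| ≤ η * |x| ^ m := by
  have hr := hh.tendsto_well_sub_div (l := 𝓝[>] 0)
    (nhdsWithin_mono 0 fun x hx => ne_of_gt hx) hh.expansion_right_abs
  have hl := hh.tendsto_well_sub_div (l := 𝓝[<] 0)
    (nhdsWithin_mono 0 fun x hx => ne_of_lt hx) hh.expansion_left
  have key : ∀ᶠ x in 𝓝[≠] (0 : ℝ), |well h M x - q M cp cm m x| ≤ η * |x| ^ m := by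
    rw [← nhdsLT_sup_nhdsGT, eventually_sup]
    constructor
    · filter_upwards [self_mem_nhdsWithin, hl.eventually (Metric.ball_mem_nhds 0 hη)] with x hx h1
      have hxp : 0 < |x| ^ m := Real.rpow_pos_of_pos (abs_pos.2 (ne_of_lt hx)) m
      rw [q, if_neg (not_lt.2 (le_of_lt hx))]
      rw [dist_zero_right, Real.norm_eq_abs, abs_div, abs_of_pos hxp, div_lt_iff₀ hxp] at h1
      exact h1.le
    · filter_upwards [self_mem_nhdsWithin, hr.eventually (Metric.ball_mem_nhds 0 hη)] with x hx h1
      have hxp : 0 < |x| ^ m := Real.rpow_pos_of_pos (abs_pos.2 (ne_of_gt hx)) m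
      rw [q, if_pos (Set.mem_Ioi.1 hx)]
      rw [dist_zero_right, Real.norm_eq_abs, abs_div, abs_of_pos hxp, div_lt_iff₀ hxp] at h1
      exact h1.le
  rw [eventually_nhdsWithin_iff, Metric.eventually_nhds_iff] at key
  obtain ⟨r, hr0, hr1⟩ := key
  refine ⟨r, hr0, fun x hx => ?_⟩
  by_cases hx0 : x = 0
  · subst hx0
    simp [well, q, hh.apply_zero, Real.zero_rpow hh.m_pos.ne']
  · exact hr1 (by simpa using hx) hx0

lemma exists_q_lower : ∃ k > 0, ∀ x, k * |x| ^ m ≤ q M cp cm m x := by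
  have := hh.M_pos
  have h1 : 0 < min cp cm := lt_min hh.cp_pos hh.cm_pos
  have hpi := Real.pi_pos
  refine ⟨2 * Real.pi ^ 2 / M ^ 3 * min cp cm, by positivity, fun x => ?_⟩
  rw [q]
  gcongr
  split_ifs
  · exact min_le_left _ _
  · exact min_le_right _ _

/-- Away from the origin the well is bounded below by a positive constant. -/
lemma exists_well_lower {r : ℝ} (hr : 0 < r) : ∃ k > 0, ∀ x, r ≤ |x| → k ≤ well h M x := by
  have hM := hh.M_pos
  obtain ⟨b, hb1, hb2⟩ := exists_between hh.limsup_lt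
  have hbd : IsBoundedUnder (· ≤ ·) (cocompact ℝ) h := isBoundedUnder_of ⟨M, hh.le_M⟩
  have hev := eventually_lt_of_limsup_lt hb1 hbd
  obtain ⟨K, hK, hKc⟩ := mem_cocompact.1 hev
  have hKr : IsCompact (K ∩ {x : ℝ | r ≤ |x|}) :=
    hK.inter_right (isClosed_le continuous_const continuous_abs)
  obtain ⟨k, hk0, hk⟩ := hKr.exists_forall_le' (f := well h M) (a := 0)
    hh.continuous_well.continuousOn fun x hx => hh.well_pos (abs_pos.1 (hr.trans_le hx.2))
  set b' := max b (M / 2)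
  have hb'M : b' < M := max_lt hb2 (by linarith)
  have hb'0 : 0 < b' := lt_max_of_lt_right (by linarith)
  have hpi := Real.pi_pos
  have hk' : 0 < Real.pi ^ 2 * (1 / b' ^ 2 - 1 / M ^ 2) := by
    have h3 : 1 / M ^ 2 < 1 / b' ^ 2 := by gcongr
    exact mul_pos (by positivity) (by linarith)
  refine ⟨min k (Real.pi ^ 2 * (1 / b' ^ 2 - 1 / M ^ 2)), lt_min hk0 hk', fun x hx => ?_⟩
  by_cases hxK : x ∈ K
  · exact (min_le_left _ _).trans (hk x ⟨hxK, hx⟩)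
  · have h4 : h x < b := hKc hxK
    exact (min_le_right _ _).trans (hh.well_mono (h4.le.trans (le_max_left _ _)))

/-- A common lower bound for the well and for `q`. -/
lemma exists_lower : ∃ k > 0, ∀ x, k * min (|x| ^ m) 1 ≤ well h M x ∧
    k * min (|x| ^ m) 1 ≤ q M cp cm m x := by
  obtain ⟨k₁, hk₁, h1⟩ := hh.exists_q_lower
  obtain ⟨r, hr, h2⟩ := hh.exists_abs_well_sub_q_le (half_pos hk₁)
  obtain ⟨k₂, hk₂, h3⟩ := hh.exists_well_lower hr
  refine ⟨min (k₁ / 2) k₂, lt_min (half_pos hk₁) hk₂, fun x => ?_⟩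
  have hp : 0 ≤ |x| ^ m := by positivity
  have hmin : 0 ≤ min (|x| ^ m) 1 := le_min hp zero_le_one
  have hA : min (k₁ / 2) k₂ * min (|x| ^ m) 1 ≤ k₁ / 2 * |x| ^ m :=
    mul_le_mul (min_le_left _ _) (min_le_left _ _) hmin (half_pos hk₁).le
  constructor
  · rcases lt_or_ge |x| r with hx | hx
    · have := (abs_le.1 (h2 x hx)).1
      have := h1 x
      linarith
    · calc min (k₁ / 2) k₂ * min (|x| ^ m) 1 ≤ k₂ * 1 :=
            mul_le_mul (min_le_right _ _) (min_le_right _ _) hmin hk₂.le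
        _ ≤ well h M x := by rw [mul_one]; exact h3 x hx
  · have := h1 x
    have : 0 ≤ k₁ / 2 * |x| ^ m := by positivity
    linarith

/-- The `L¹` distance of the two potentials near the origin, at the scale `δ` with
`δ ^ (m + 2) = ε ^ 2`. -/
lemma exists_integral_abs_sub_le {Y η : ℝ} (hY : 0 < Y) (hη : 0 < η) :
    ∃ ρ > 0, ∃ β, ∀ ε δ : ℝ, 0 < ε → 0 < δ → δ ^ (m + 2) = ε ^ 2 → 2 * (Y * δ) < ρ →
      δ * ∫ x in Set.Icc (-(2 * (Y * δ))) (2 * (Y * δ)), |W h M ε x - q M cp cm m x / ε ^ 2| ≤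
        η * (4 * Y * (2 * Y) ^ m) + δ * β := by
  obtain ⟨r, hr, h1⟩ := hh.exists_abs_well_sub_q_le hη
  refine ⟨min r 1, lt_min hr one_pos, ∫ x in Set.Icc (-1) 1, derivPot h x, ?_⟩
  intro ε δ hε hδ hδε hρ
  set a := 2 * (Y * δ) with ha
  have ha0 : 0 < a := by positivity
  have hi1 : IntegrableOn (derivPot h) (Set.Icc (-1) 1) :=
    hh.locallyIntegrable_derivPot.integrableOn_isCompact isCompact_Icc
  have hsub : Set.Icc (-a) a ⊆ Set.Icc (-1) 1 := by
    have := hρ.trans_le (min_le_right _ _)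
    exact Set.Icc_subset_Icc (by linarith) this.le
  have hi2 : IntegrableOn (fun _ : ℝ => η * a ^ m / ε ^ 2) (Set.Icc (-a) a) :=
    integrableOn_const (by simp)
  have hi3 : IntegrableOn (fun x => |W h M ε x - q M cp cm m x / ε ^ 2|) (Set.Icc (-a) a) :=
    (((hh.locallyIntegrable_W ε).sub (hh.locallyIntegrable_q_div ε)).integrableOn_isCompact
      isCompact_Icc).norm
  have hpt : ∀ x ∈ Set.Icc (-a) a, |W h M ε x - q M cp cm m x / ε ^ 2| ≤
      η * a ^ m / ε ^ 2 + derivPot h x := by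
    intro x hx
    have hxa : |x| ≤ a := abs_le.2 hx
    have h2 := h1 x (hxa.trans_lt (hρ.trans_le (min_le_left _ _)))
    have h3 : W h M ε x - q M cp cm m x / ε ^ 2 =
        (well h M x - q M cp cm m x) / ε ^ 2 + derivPot h x := by
      rw [W_eq]
      ring
    rw [h3]
    refine (abs_add_le _ _).trans ?_
    rw [abs_of_nonneg (derivPot_nonneg h x), abs_div, abs_of_pos (pow_pos hε 2)]
    gcongr
    refine h2.trans ?_
    gcongr
    exact hh.m_pos.le
  have h4 : ∫ x in Set.Icc (-a) a, |W h M ε x - q M cp cm m x / ε ^ 2| ≤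
      2 * a * (η * a ^ m / ε ^ 2) + ∫ x in Set.Icc (-1) 1, derivPot h x := by
    have hi4 := hi1.mono_set hsub
    refine (setIntegral_mono_on hi3 (hi2.fun_add hi4) measurableSet_Icc hpt).trans ?_
    rw [integral_add hi2 hi4, setIntegral_const, smul_eq_mul,
      Real.volume_real_Icc_of_le (by linarith)]
    refine add_le_add (le_of_eq (by ring)) ?_
    exact setIntegral_mono_set hi1 (Eventually.of_forall (derivPot_nonneg h))
      (LE.le.eventuallyLE hsub)
  refine (mul_le_mul_of_nonneg_left h4 hδ.le).trans (le_of_eq ?_)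
  have h5 : a ^ m = (2 * Y) ^ m * δ ^ m := by
    rw [ha, ← mul_assoc, Real.mul_rpow (by positivity) hδ.le]
  have h6 : δ ^ m * δ ^ 2 = ε ^ 2 := by
    rw [← hδε, Real.rpow_add hδ]
    norm_num
  rw [mul_add, h5]
  congr 1
  have hε2 : ε ^ 2 ≠ 0 := by positivity
  calc δ * (2 * a * (η * ((2 * Y) ^ m * δ ^ m) / ε ^ 2))
      = η * (4 * Y * (2 * Y) ^ m) * ((δ ^ m * δ ^ 2) / ε ^ 2) := by rw [ha]; ring
    _ = η * (4 * Y * (2 * Y) ^ m) := by rw [h6, div_self hε2, mul_one]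

end IsProfile

end profile

/-! ### Norm resolvent convergence -/

section convergence

variable {𝕜 : Type*} [RCLike 𝕜]

lemma exists_isScaledSolution {V : ℝ → ℝ} {c δ : ℝ} (hc : 0 < c) (hδ : 0 < δ)
    (hco : ∀ u : formDomain 𝕜 V, ‖(u : L2 𝕜)‖ ^ 2 ≤ c * energy u) :
    ∃ T : L2 𝕜 →L[𝕜] L2 𝕜, IsScaledSolution V δ T := by
  obtain ⟨T, hT⟩ := exists_form_solution hc hco
  have hδ' : ((δ ^ 2 : ℝ) : 𝕜) ≠ 0 := by
    rw [Ne, RCLike.ofReal_eq_zero]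
    positivity
  refine ⟨T.comp (((δ ^ 2 : ℝ) : 𝕜)⁻¹ • ContinuousLinearMap.id 𝕜 (L2 𝕜)), fun f => ?_⟩
  obtain ⟨hu, h⟩ := hT (((δ ^ 2 : ℝ) : 𝕜)⁻¹ • f)
  refine ⟨hu, fun v => ?_⟩
  refine (congrArg _ (h v)).trans ?_
  rw [inner_smul_left, map_inv₀, RCLike.conj_ofReal, mul_inv_cancel_left₀ hδ']

/-- With `δ ^ (m + 2) = ε ^ 2`, the bound `k min (|x| ^ m) 1 / ε ^ 2` exceeds
`k Y ^ m / δ ^ 2` where `|x| ≥ Y δ`, as long as `Y δ ≤ 1`. -/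
lemma div_sq_le_of_lower {m k Y δ ε x : ℝ} (hm : 0 < m) (hk : 0 < k) (hY : 0 < Y) (hδ : 0 < δ)
    (hε : 0 < ε) (hδε : δ ^ (m + 2) = ε ^ 2) (hYδ : Y * δ ≤ 1) (hx : Y * δ ≤ |x|) :
    k * Y ^ m / δ ^ 2 ≤ k * min (|x| ^ m) 1 / ε ^ 2 := by
  have h1 : (Y * δ) ^ m ≤ min (|x| ^ m) 1 :=
    le_min (Real.rpow_le_rpow (by positivity) hx hm.le)
      (Real.rpow_le_one (by positivity) hYδ hm.le)
  have h2 : δ ^ m * δ ^ 2 = ε ^ 2 := by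
    rw [← hδε, Real.rpow_add hδ]
    norm_num
  have h3 : 0 < δ ^ m := by positivity
  calc k * Y ^ m / δ ^ 2 = k * (Y * δ) ^ m / ε ^ 2 := by
        rw [← h2, Real.mul_rpow hY.le hδ.le]
        field_simp
    _ ≤ k * min (|x| ^ m) 1 / ε ^ 2 := by gcongr

lemma well_div_le_W (h : ℝ → ℝ) (M ε x : ℝ) : well h M x / ε ^ 2 ≤ W h M ε x := by
  rw [W_eq]
  linarith [derivPot_nonneg h x]

namespace IsProfile

variable {h : ℝ → ℝ} {M cp cm m : ℝ} (hh : IsProfile h M cp cm m)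
include hh

/-- Both forms are coercive for every `ε`. -/
lemma exists_coercive {ε : ℝ} (hε : 0 < ε) : ∃ c > 0,
    (∀ u : formDomain 𝕜 (W h M ε), ‖(u : L2 𝕜)‖ ^ 2 ≤ c * energy u) ∧
    ∀ u : formDomain 𝕜 (fun x => q M cp cm m x / ε ^ 2), ‖(u : L2 𝕜)‖ ^ 2 ≤ c * energy u := by
  obtain ⟨k, hk, hlow⟩ := hh.exists_lower
  have hlow' : ∀ x, 1 ≤ |x| → k / ε ^ 2 ≤ well h M x / ε ^ 2 ∧
      k / ε ^ 2 ≤ q M cp cm m x / ε ^ 2 := by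
    intro x hx
    have h1 : min (|x| ^ m) 1 = 1 := min_eq_right (Real.one_le_rpow hx hh.m_pos.le)
    have h2 := hlow x
    rw [h1, mul_one] at h2
    exact ⟨by gcongr; exact h2.1, by gcongr; exact h2.2⟩
  refine ⟨5 / (k / ε ^ 2) + 12 * 1 ^ 2, by positivity, fun u => ?_, fun u => ?_⟩
  · exact norm_sq_le_energy (hh.W_nonneg ε) one_pos (by positivity)
      (fun x hx => (hlow' x hx).1.trans (well_div_le_W h M ε x)) u
  · exact norm_sq_le_energy (fun x => div_nonneg (hh.q_nonneg x) (by positivity)) one_pos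
      (by positivity) (fun x hx => (hlow' x hx).2) u

/-- The distance of the two solution operators tends to zero. -/
lemma exists_norm_sub_lt {ζ : ℝ} (hζ : 0 < ζ) : ∃ ρ > 0, ∀ (ε δ : ℝ) (R S : L2 𝕜 →L[𝕜] L2 𝕜),
    0 < ε → 0 < δ → δ < ρ → δ ^ (m + 2) = ε ^ 2 → IsScaledSolution (W h M ε) δ R →
    IsScaledSolution (fun x => q M cp cm m x / ε ^ 2) δ S → ‖R - S‖ < ζ := by
  obtain ⟨B, hB, hcomp⟩ := exists_norm_sub_le (𝕜 := 𝕜)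
  obtain ⟨k, hk, hlow⟩ := hh.exists_lower
  set c := 5 / k + 12 with hc
  have hc0 : 0 < c := by positivity
  -- the cutoff at distance `Y δ` costs little when `Y` is large
  obtain ⟨Y, hY1, hYζ⟩ : ∃ Y : ℝ, 1 ≤ Y ∧
      2 * √c / √(k * Y ^ m) + B * c * √c / Y < ζ / 2 := by
    have h1 : Tendsto (fun Y : ℝ => √(k * Y ^ m)) atTop atTop :=
      Real.tendsto_sqrt_atTop.comp ((tendsto_rpow_atTop hh.m_pos).const_mul_atTop hk)
    have h2 : Tendsto (fun Y : ℝ => 2 * √c / √(k * Y ^ m) + B * c * √c / Y) atTop (𝓝 0) := by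
      simpa using (h1.const_div_atTop (2 * √c)).add (tendsto_id.const_div_atTop (B * c * √c))
    obtain ⟨Y, hY⟩ := ((eventually_ge_atTop 1).and
      (h2.eventually (gt_mem_nhds (half_pos hζ)))).exists
    exact ⟨Y, hY⟩
  have hY0 : 0 < Y := by linarith
  -- with `Y` fixed, the potentials are close in `L¹` at the scale `Y δ`
  set A := 2 * (c ^ 2 + c) with hA
  have hA0 : 0 < A := by positivity
  set C := A * (4 * Y * (2 * Y) ^ m) with hC
  have hC0 : 0 < C := by positivity
  obtain ⟨ρ, hρ, β, hint⟩ := hh.exists_integral_abs_sub_le hY0 (η := ζ / (4 * C)) (by positivity)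
  refine ⟨min (1 / Y) (min (ρ / (2 * Y)) (ζ / (4 * (A * (|β| + 1))))), by positivity, ?_⟩
  intro ε δ R S hε hδ hδρ hδε hR hS
  have hδ1 : Y * δ ≤ 1 := by
    have := hδρ.le.trans (min_le_left _ _)
    rwa [le_div_iff₀ hY0, mul_comm] at this
  have hδ2 : 2 * (Y * δ) < ρ := by
    have := hδρ.trans_le ((min_le_right _ _).trans (min_le_left _ _))
    rw [lt_div_iff₀ (by positivity)] at this
    linarith
  have hδ3 : δ * (A * (|β| + 1)) < ζ / 4 := by
    have := hδρ.trans_le ((min_le_right _ _).trans (min_le_right _ _))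
    rw [lt_div_iff₀ (by positivity)] at this
    linarith
  have hδle : 1 * δ ≤ 1 := (mul_le_mul_of_nonneg_right hY1 hδ.le).trans hδ1
  have hVW := hh.W_nonneg ε
  have hVq : ∀ x, 0 ≤ q M cp cm m x / ε ^ 2 := fun x =>
    div_nonneg (hh.q_nonneg x) (by positivity)
  have hbound : ∀ Z : ℝ, 0 < Z → Z * δ ≤ 1 → ∀ x, Z * δ ≤ |x| →
      k * Z ^ m / δ ^ 2 ≤ W h M ε x ∧ k * Z ^ m / δ ^ 2 ≤ q M cp cm m x / ε ^ 2 := by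
    intro Z hZ hZδ x hx
    have h1 := div_sq_le_of_lower hh.m_pos hk hZ hδ hε hδε hZδ hx
    have h2 := hlow x
    refine ⟨h1.trans (le_trans ?_ (well_div_le_W h M ε x)), h1.trans ?_⟩
    · gcongr
      exact h2.1
    · gcongr
      exact h2.2
  -- coercivity, uniformly in `ε`, from the bound outside `[-δ, δ]`
  have hb1 := hbound 1 one_pos hδle
  simp only [Real.one_rpow, mul_one, one_mul] at hb1
  have hconst : 5 / (k / δ ^ 2) + 12 * δ ^ 2 = c * δ ^ 2 := by
    rw [hc]
    field_simp
  have hcoW : ∀ u : formDomain 𝕜 (W h M ε), ‖(u : L2 𝕜)‖ ^ 2 ≤ c * (δ ^ 2 * energy u) := by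
    intro u
    have := norm_sq_le_energy hVW hδ (by positivity) (fun x hx => (hb1 x hx).1) u
    rwa [hconst, mul_assoc] at this
  have hcoq : ∀ u : formDomain 𝕜 (fun x => q M cp cm m x / ε ^ 2),
      ‖(u : L2 𝕜)‖ ^ 2 ≤ c * (δ ^ 2 * energy u) := by
    intro u
    have := norm_sq_le_energy hVq hδ (by positivity) (fun x hx => (hb1 x hx).2) u
    rwa [hconst, mul_assoc] at this
  have hbY := hbound Y hY0 hδ1
  have key := hcomp hVW hVq (hh.locallyIntegrable_W ε) (hh.locallyIntegrable_q_div ε) hδ hc0 hY0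
    (by positivity) hcoW hcoq hR hS (fun x hx => (hbY x hx).1) (fun x hx => (hbY x hx).2)
  have h3 := mul_le_mul_of_nonneg_left (hint ε δ hε hδ hδε hδ2) hA0.le
  have h4 : A * (ζ / (4 * C) * (4 * Y * (2 * Y) ^ m) + δ * β) = ζ / 4 + δ * (A * β) := by
    have : A * (ζ / (4 * C) * (4 * Y * (2 * Y) ^ m)) = ζ / (4 * C) * C := by rw [hC]; ring
    rw [mul_add, this]
    field_simp
  have h5 : δ * (A * β) ≤ δ * (A * (|β| + 1)) := by
    gcongr
    linarith [le_abs_self β]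
  rw [h4] at h3
  linarith

end IsProfile

end convergence

end ThinStrip

theorem theorem1 {𝕜 : Type*} [RCLike 𝕜] (h : ℝ → ℝ) (M cp cm m α : ℝ)
    (hh : ThinStrip.IsProfile h M cp cm m) (hα : α = 2 / (m + 2)) :
    ∃ R S : ℝ → (ThinStrip.L2 𝕜 →L[𝕜] ThinStrip.L2 𝕜),
      (∀ ε : ℝ, 0 < ε → ThinStrip.IsBoundedInverse
        (((ε ^ (2 * α) : ℝ) : 𝕜) • ThinStrip.Q 𝕜 h M ε) (R ε)) ∧
      (∀ ε : ℝ, 0 < ε → ThinStrip.IsBoundedInverse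
        (((ε ^ (2 * α) : ℝ) : 𝕜) • ThinStrip.H 𝕜 M cp cm m ε) (S ε)) ∧
      Tendsto (fun ε => ‖R ε - S ε‖) (𝓝[>] (0 : ℝ)) (𝓝 0) := by
  have hm := hh.m_pos
  have hscale : ∀ ε : ℝ, 0 < ε → (ε ^ α) ^ (m + 2) = ε ^ 2 := by
    intro ε hε
    rw [← Real.rpow_mul hε.le, hα, div_mul_cancel₀ _ (by linarith), Real.rpow_two]
  have hsq : ∀ ε : ℝ, 0 < ε → ε ^ (2 * α) = (ε ^ α) ^ 2 := by
    intro ε hε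
    rw [mul_comm, Real.rpow_mul hε.le, Real.rpow_two]
  have hR : ∀ ε : ℝ, ∃ T : ThinStrip.L2 𝕜 →L[𝕜] ThinStrip.L2 𝕜,
      0 < ε → ThinStrip.IsScaledSolution (ThinStrip.W h M ε) (ε ^ α) T := by
    intro ε
    by_cases hε : 0 < ε
    · obtain ⟨c, hc, h1, -⟩ := hh.exists_coercive (𝕜 := 𝕜) hε
      obtain ⟨T, hT⟩ := ThinStrip.exists_isScaledSolution hc (Real.rpow_pos_of_pos hε α) h1
      exact ⟨T, fun _ => hT⟩
    · exact ⟨0, fun h' => absurd h' hε⟩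
  have hS : ∀ ε : ℝ, ∃ T : ThinStrip.L2 𝕜 →L[𝕜] ThinStrip.L2 𝕜,
      0 < ε → ThinStrip.IsScaledSolution
        (fun x => ThinStrip.q M cp cm m x / ε ^ 2) (ε ^ α) T := by
    intro ε
    by_cases hε : 0 < ε
    · obtain ⟨c, hc, -, h1⟩ := hh.exists_coercive (𝕜 := 𝕜) hε
      obtain ⟨T, hT⟩ := ThinStrip.exists_isScaledSolution hc (Real.rpow_pos_of_pos hε α) h1
      exact ⟨T, fun _ => hT⟩
    · exact ⟨0, fun h' => absurd h' hε⟩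
  choose R hR using hR
  choose S hS using hS
  refine ⟨R, S, fun ε hε => ?_, fun ε hε => ?_, ?_⟩
  · obtain ⟨c, -, h1, -⟩ := hh.exists_coercive (𝕜 := 𝕜) hε
    rw [hsq ε hε]
    exact ThinStrip.isBoundedInverse_of_form_solution (hh.W_nonneg ε) (hh.locallyIntegrable_W ε)
      (pow_pos (Real.rpow_pos_of_pos hε α) 2) h1 (hR ε hε)
  · obtain ⟨c, -, -, h1⟩ := hh.exists_coercive (𝕜 := 𝕜) hε
    rw [hsq ε hε]
    exact ThinStrip.isBoundedInverse_of_form_solution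
      (fun x => div_nonneg (hh.q_nonneg x) (sq_nonneg ε)) (hh.locallyIntegrable_q_div ε)
      (pow_pos (Real.rpow_pos_of_pos hε α) 2) h1 (hS ε hε)
  · rw [Metric.tendsto_nhds]
    intro ζ hζ
    obtain ⟨ρ, hρ, hlt⟩ := hh.exists_norm_sub_lt (𝕜 := 𝕜) hζ
    have hα0 : 0 < α := hα ▸ by positivity
    have h1 : Tendsto (fun ε : ℝ => ε ^ α) (𝓝[>] 0) (𝓝 0) :=
      ((Real.continuous_rpow_const hα0.le).tendsto' 0 0 (Real.zero_rpow hα0.ne')).mono_left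
        nhdsWithin_le_nhds
    filter_upwards [self_mem_nhdsWithin, h1.eventually (gt_mem_nhds hρ)] with ε hε hερ
    rw [dist_zero_right, norm_norm]
    exact hlt ε _ _ _ hε (Real.rpow_pos_of_pos hε α) hερ (hscale ε hε) (hR ε hε) (hS ε hε)
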